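/- Fix a universe $\mathcal U$; "small" means $\mathcal U$-small. All categories have small hom-sets and are equivalent to a category whose objects and arrows belong to $\mathcal U$. **Presites.** A sink on $X$ is a set of arrows with target $X$; it is *epi* if it is jointly epimorphic. An arrow is *pullbackable* if its pullback along every arrow exists. A *presite* $(\mathcal C,\tau)$ is a category with a pretopology: a class of sinks (coverings) consisting of pullbackable arrows, containing the isomorphisms, stable under base change and composition. An arrow is *clopen* if it belongs to some covering; it is required moreover that every sink of clopen arrows which has a refinement that is a covering is a covering. It is a *$\mathcal U$-presite* if for every object $X$ there is a small set $G_X$ of objects such that the source of any clopen arrow $U\to X$ has a covering by arrows with sources in $G_X$. A functor between presites is *continuous* if it preserves coverings and pullbacks of clopen arrows along arbitrary arrows. **Glutoses.** A *$\mathcal U$-glutos* is a pair $(\mathcal G,\mathcal O)$ where $\mathcal O$ is a class of pullbackable arrows (called open) of $\mathcal G$ containing the isomorphisms, stable under composition and base change, such that: (1) $fg\in\mathcal O$ and $f\in\mathcal O$ imply $g\in\mathcal O$; (2) for every $X$ the full subcategory $\mathcal O/X\subset\mathcal G/X$ on the arrows in $\mathcal O$ is a Grothendieck topos (relative to $\mathcal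 U$), and for every $f:X\to Y$ base change $f^*:\mathcal O/Y\to\mathcal O/X$ is the inverse image part of a geometric morphism; (3) $\mathcal G$ has small disjoint universal coproducts with open injections, and an arrow from a small coproduct is open if its components are; (4) open epimorphisms are effective; if $p$ is an open epimorphism and $fp$ is open then $f$ is open; every equivalence relation $d_0,d_1:U\rightrightarrows X$ with $d_0,d_1\in\mathcal O$ for which there is an epi sink $\{u_i:U_i\to X\}$ of open arrows such that each inverse image $u_i^*(d_0,d_1)$ is coequalized by some open arrow, is effective and has an open universal coequalizer; (5) if $r:X\to R$ is an open epimorphism and $g:R\to S$, $f:Y\to S$ are arrows such that the pullback of $f$ along $gr$ exists, then the pullback of $f$ along $g$ exists. A $\mathcal U$-glutos is regarded as a presite whose coverings are the epi sinks of open arrows. A *universal $\mathcal U$-glutos* of a $\mathcal U$-presite $\mathcal P$ is a $\mathcal U$-glutos $\widetilde{\mathcal P}$ with a continuous functor $Y:\mathcal P\to\widetilde{\mathcal P}$ such that for every $\mathcal U$-glutos $\mathcal D$ composition with $Y$ is an equivalence from the category of continuous functors $\widetilde{\mathcal P}\to\mathcal D$ (with all natural transformations) to that of continuous functors $\mathcal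 P\to\mathcal D$. **Nearly glutoses.** A $\mathcal U$-presite is a *nearly $\mathcal U$-glutos* if, for some $\mathcal U$-presite $\mathcal P$, it is equivalent as a presite (by an equivalence continuous in both directions) to $\widetilde{\mathcal P}$ equipped with those of its coverings that consist of monomorphisms. **Proposition.** Let $(\mathcal C,\tau)$ be a nearly $\mathcal U$-glutos and $X$ an object of $\mathcal C$. Let $\mathcal O(X)$ be the partially ordered set of clopen subobjects of $X$. Let $\mathcal{LO}$ be the class of locally clopen arrows, i.e. of arrows $f:Y\to Z$ such that for some covering $\{u_i\}$ of $Y$ all $fu_i$ are clopen, and $\mathcal{LO}/X$ the full subcategory of $\mathcal C/X$ on the arrows in $\mathcal{LO}$. For $u\in\mathcal O(X)$ let $su$ be a clopen arrow to $X$ representing $u$, viewed as an object of $\mathcal{LO}/X$. Then: (a) $\mathcal O(X)$ is small and is a complete Heyting algebra, and the category $\mathrm{Sh}\,X$ of sheaves of small sets on $\mathcal O(X)$ is an SG-topos, that is, a Grothendieck topos in which the subobjects of $1$ generate. (b) There is an equivalence of categories $J:\mathrm{Sh}\,X\to\mathcal{LO}/X$ with isomorphisms $\beta: F(u)\cong\mathrm{Hom}_{\mathcal{LO}/X}(su,JF)$,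 natural in $u\in\mathcal O(X)$ and in the sheaf $F$; that is, $F$ is the sheaf of sections of $JF$. (c) For every sheaf $F$, order the set $I_F=\coprod_{u\in\mathcal O(X)}F(u)$ by $\langle u,x\rangle\le\langle v,y\rangle$ iff $u\le v$ and $x=y|_u$. Then any two elements of $I_F$ have a meet, and $JF$ is obtained by gluing the copies of $su$ indexed by $\langle u,x\rangle\in I_F$ along these meets: the arrows $\beta(x):su\to JF$ exhibit $JF$ as the colimit in $\mathcal{LO}/X$ of the diagram consisting of the objects $su$ for $\langle u,x\rangle\in I_F$, the objects $sw$ for $\langle u,x\rangle\wedge\langle v,y\rangle=\langle w,z\rangle$, and the inclusions $su\leftarrow sw\to sv$. -/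

import Mathlib

open CategoryTheory Limits Opposite

universe w w' w'' v' v'' u

namespace Glutos

/-! ### Pretopologies and presites

A sink on `X` is a set of arrows with target `X`, that is, a `Presieve X`; a set of sinks is a
`Precoverage`. -/

section Presites

variable {C : Type w} [Category.{u} C]

/-- The clopen arrows of `τ`: those which belong to some covering. -/
def clopen (τ : Precoverage C) : MorphismProperty C :=
  fun _ X f => ∃ S ∈ τ X, S f

/-- `τ` is a pretopology: its coverings consist of pullbackable arrows, isomorphisms are coverings,
and coverings are stable under base change and under composition. Moreover `τ` is complete: a sink
of clopen arrows which has a refinement that is a covering is itself a covering. -/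
class IsPresite (τ : Precoverage C) : Prop extends
    τ.HasPullbacks, τ.HasIsos, τ.IsStableUnderBaseChange, τ.IsStableUnderComposition where
  mem_of_refinement : ∀ ⦃X : C⦄ (S R : Presieve X),
    (∀ ⦃Y : C⦄ ⦃f : Y ⟶ X⦄, S f → clopen τ f) → R ∈ τ X →
    (∀ ⦃Z : C⦄ ⦃g : Z ⟶ X⦄, R g → ∃ (Y : C) (f : Y ⟶ X) (h : Z ⟶ Y), S f ∧ h ≫ f = g) →
    S ∈ τ X

/-- Existence of local small sets of topological generators, smallness being relative to the
universe of the hom-sets of the category. -/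
def HasLocalGenerators (τ : Precoverage C) : Prop :=
  ∀ X : C, ∃ (ι : Type u) (G : ι → C), ∀ ⦃U : C⦄ (f : U ⟶ X), clopen τ f →
    ∃ S ∈ τ U, ∀ ⦃V : C⦄ ⦃g : V ⟶ U⦄, S g → V ∈ Set.range G

/-- Continuous functors: they respect coverings, and pullbacks of clopen arrows along arbitrary
arrows. -/
structure IsContinuous {D : Type w'} [Category.{v'} D] (τ : Precoverage C) (σ : Precoverage D)
    (F : C ⥤ D) : Prop where
  map_mem : ∀ ⦃X : C⦄ ⦃S : Presieve X⦄, S ∈ τ X → S.map F ∈ σ (F.obj X)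
  map_isPullback : ∀ ⦃P Z U X : C⦄ ⦃fst : P ⟶ Z⦄ ⦃snd : P ⟶ U⦄ ⦃g : Z ⟶ X⦄ ⦃f : U ⟶ X⦄,
    clopen τ f → IsPullback fst snd g f →
      IsPullback (F.map fst) (F.map snd) (F.map g) (F.map f)

theorem IsContinuous.map_clopen {D : Type w'} [Category.{v'} D] {τ : Precoverage C}
    {σ : Precoverage D} {F : C ⥤ D} (hF : IsContinuous τ σ F) {U X : C} {f : U ⟶ X}
    (hf : clopen τ f) : clopen σ (F.map f) := by
  obtain ⟨S, hS, hf⟩ := hf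
  exact ⟨_, hF.map_mem hS, ⟨hf⟩⟩

theorem IsContinuous.comp {D : Type w'} [Category.{v'} D] {E : Type w''} [Category.{v''} E]
    {τ : Precoverage C} {σ : Precoverage D} {ρ : Precoverage E} {F : C ⥤ D} {G : D ⥤ E}
    (hF : IsContinuous τ σ F)
    (hG : ∀ ⦃X : D⦄ ⦃S : Presieve X⦄, S ∈ σ X → S.map G ∈ ρ (G.obj X))
    (hG' : ∀ ⦃P Z U X : D⦄ ⦃fst : P ⟶ Z⦄ ⦃snd : P ⟶ U⦄ ⦃g : Z ⟶ X⦄ ⦃f : U ⟶ X⦄,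
      clopen σ f → IsPullback fst snd g f →
        IsPullback (G.map fst) (G.map snd) (G.map g) (G.map f)) :
    IsContinuous τ ρ (F ⋙ G) where
  map_mem X S hS := by
    have h := hG (hF.map_mem hS)
    have e : (S.map F).map G = S.map (F ⋙ G) := by
      refine le_antisymm ?_ ?_
      · rintro _ _ ⟨⟨h⟩⟩
        exact Presieve.map.of (F := F ⋙ G) h
      · rintro _ _ ⟨h⟩
        exact Presieve.map.of (F := G) (Presieve.map.of (F := F) h)
    rw [← e]
    exact h
  map_isPullback _ _ _ _ _ _ _ _ hf hp := hG' (hF.map_clopen hf) (hF.map_isPullback hf hp)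

/-- The pretopology of all coverings which consist of monomorphisms. -/
def monoPart (τ : Precoverage C) : Precoverage C where
  coverings X := {S | S ∈ τ X ∧ ∀ ⦃Y : C⦄ ⦃f : Y ⟶ X⦄, S f → Mono f}

/-- Locally clopen arrows: those which become clopen on some covering of their source. -/
def locallyClopen (τ : Precoverage C) : MorphismProperty C :=
  fun Y _ f => ∃ S ∈ τ Y, ∀ ⦃Z : C⦄ ⦃g : Z ⟶ Y⦄, S g → clopen τ (g ≫ f)

theorem locallyClopen_of_clopen (τ : Precoverage C) [IsPresite τ] {Y X : C} {f : Y ⟶ X}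
    (hf : clopen τ f) : locallyClopen τ f := by
  refine ⟨.singleton (𝟙 Y), Precoverage.HasIsos.mem_coverings_of_isIso (𝟙 Y), ?_⟩
  rintro _ _ ⟨⟩
  simpa using hf

end Presites

/-! ### Glutoses -/

section Glutos

variable {C : Type w} [Category.{u} C]

/-- A sink is epi when it is jointly epimorphic. -/
def IsEpiSink {X : C} (S : Presieve X) : Prop :=
  ∀ ⦃Z : C⦄ (a b : X ⟶ Z), (∀ ⦃Y : C⦄ ⦃f : Y ⟶ X⦄, S f → f ≫ a = f ≫ b) → a = b

/-- `d₀, d₁` is an equivalence relation on `X`: it identifies `Hom(T, U)`, for every `T`, with an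
equivalence relation on the set `Hom(T, X)`. -/
def IsEquivRel {U X : C} (d₀ d₁ : U ⟶ X) : Prop :=
  ∀ T : C, (∀ s t : T ⟶ U, s ≫ d₀ = t ≫ d₀ → s ≫ d₁ = t ≫ d₁ → s = t) ∧
    Equivalence (fun a b : T ⟶ X => ∃ t : T ⟶ U, t ≫ d₀ = a ∧ t ≫ d₁ = b)

/-- `d₀', d₁' : U' ⟶ X'` is the inverse image of `d₀, d₁ : U ⟶ X` along `f : X' ⟶ X`. -/
def IsInverseImage {U X U' X' : C} (d₀ d₁ : U ⟶ X) (f : X' ⟶ X) (d₀' d₁' : U' ⟶ X') : Prop :=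
  ∃ (U₀ U₁ : C) (a₀ : U₀ ⟶ X') (b₀ : U₀ ⟶ U) (b₁ : U₁ ⟶ U) (a₁ : U₁ ⟶ X')
    (c₀ : U' ⟶ U₀) (c₁ : U' ⟶ U₁),
    IsPullback a₀ b₀ f d₀ ∧ IsPullback b₁ a₁ d₁ f ∧ IsPullback c₀ c₁ b₀ b₁ ∧
      d₀' = c₀ ≫ a₀ ∧ d₁' = c₁ ≫ a₁

/-- `d₀, d₁` is `O`-coequalizable when some arrow of `O` coequalizes it. -/
def IsCoequalizable (O : MorphismProperty C) {U X : C} (d₀ d₁ : U ⟶ X) : Prop :=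
  ∃ (Q : C) (q : X ⟶ Q), O q ∧ d₀ ≫ q = d₁ ≫ q

/-- `d₀, d₁` is locally `O`-coequalizable: its inverse images along the members of some epi sink of
arrows of `O` are `O`-coequalizable. -/
def IsLocallyCoequalizable (O : MorphismProperty C) {U X : C} (d₀ d₁ : U ⟶ X) : Prop :=
  ∃ S : Presieve X, IsEpiSink S ∧ ∀ ⦃X' : C⦄ ⦃f : X' ⟶ X⦄, S f → O f ∧
    ∃ (U' : C) (d₀' d₁' : U' ⟶ X'), IsInverseImage d₀ d₁ f d₀' d₁' ∧ IsCoequalizable O d₀' d₁'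

/-- `E` is a Grothendieck topos relative to the universe `u`: it is equivalent to the category of
sheaves of sets on a small site. -/
def IsTopos (E : Type w') [Category.{v'} E] : Prop :=
  ∃ (D : Type u) (_ : SmallCategory D) (J : GrothendieckTopology D),
    Nonempty (E ≌ Sheaf J (Type u))

/-- `E` is an SG-topos: a Grothendieck topos in which the subobjects of the terminal object form a
generating class. -/
def IsSGTopos (E : Type w') [Category.{v'} E] : Prop :=
  IsTopos.{w', v', u} E ∧ ObjectProperty.IsSeparating (fun A : E => IsSubterminal A)

/-- A clopos structure: the arrows of `O` are pullbackable, and `O` contains all isomorphisms and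
is stable under composition and pullback. -/
class IsClopos (O : MorphismProperty C) : Prop extends
    O.IsMultiplicative, O.IsStableUnderBaseChange where
  hasPullback : ∀ ⦃U X Y : C⦄ (f : U ⟶ X) (g : Y ⟶ X), O f → HasPullback f g

instance (O : MorphismProperty C) [IsClopos O] {X Y : C} (f : X ⟶ Y) : O.HasPullbacksAlong f where
  hasPullback g hg := IsClopos.hasPullback g f hg

/-- `(C, O)` is a glutos relative to the universe `u` of the hom-sets of `C`. Small means small in
this universe, and `O.Over ⊤ X` is the full subcategory of the category of arrows over `X` formed
by the arrows in `O`. -/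
class IsGlutos (O : MorphismProperty C) : Prop extends IsClopos O where
  /-- If `f` and `g ≫ f` are open then so is `g`. -/
  of_postcomp : ∀ ⦃X Y Z : C⦄ (g : X ⟶ Y) (f : Y ⟶ Z), O f → O (g ≫ f) → O g
  /-- The category of open arrows over any object is a topos. -/
  isTopos : ∀ X : C, IsTopos.{max w u, u, u} (O.Over ⊤ X)
  /-- Base change is the inverse image part of a geometric morphism: it has a right adjoint. -/
  isLeftAdjoint : ∀ ⦃X Y : C⦄ (f : X ⟶ Y),
    (MorphismProperty.Over.pullback O ⊤ f).IsLeftAdjoint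
  /-- Base change is the inverse image part of a geometric morphism: it is left exact. -/
  preservesFiniteLimits : ∀ ⦃X Y : C⦄ (f : X ⟶ Y),
    PreservesFiniteLimits (MorphismProperty.Over.pullback O ⊤ f)
  /-- Small coproducts exist, are universal, and their injections are open. -/
  exists_coproduct : ∀ ⦃ι : Type u⦄ (X : ι → C),
    ∃ c : Cofan X, IsUniversalColimit c ∧ ∀ i, O (c.inj i)
  /-- Small coproducts are disjoint. -/
  coproductDisjoint : ∀ ⦃ι : Type u⦄ (X : ι → C), CoproductDisjoint X
  /-- An arrow from a small coproduct is open if its components are open. -/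
  of_coproduct : ∀ ⦃ι : Type u⦄ ⦃X : ι → C⦄ (c : Cofan X), IsColimit c →
    ∀ ⦃Y : C⦄ (f : c.pt ⟶ Y), (∀ i, O (c.inj i ≫ f)) → O f
  /-- Open epimorphisms are effective. -/
  effectiveEpi : ∀ ⦃X Y : C⦄ (f : X ⟶ Y), O f → Epi f → EffectiveEpi f
  /-- If `p` is an epimorphism, and `p` and `p ≫ f` are open, then `f` is open. -/
  of_precomp : ∀ ⦃X Y Z : C⦄ (p : X ⟶ Y) (f : Y ⟶ Z), Epi p → O p → O (p ≫ f) → O f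
  /-- An open, locally coequalizable equivalence relation has an open universal coequalizer, of
  which it is the kernel pair. -/
  exists_coequalizer : ∀ ⦃U X : C⦄ (d₀ d₁ : U ⟶ X), IsEquivRel d₀ d₁ → O d₀ → O d₁ →
    IsLocallyCoequalizable O d₀ d₁ → ∃ (Q : C) (q : X ⟶ Q) (hq : d₀ ≫ q = d₁ ≫ q),
      O q ∧ IsUniversalColimit (Cofork.ofπ q hq) ∧ IsKernelPair q d₀ d₁
  /-- Pullbacks may be constructed locally on the base. -/
  hasPullback_of_local : ∀ ⦃X R S Y : C⦄ (r : X ⟶ R) (g : R ⟶ S) (f : Y ⟶ S),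
    O r → Epi r → HasPullback f (r ≫ g) → HasPullback f g

/-- The canonical pretopology of a glutos: its coverings are the epi sinks of open arrows. -/
def openEpi (O : MorphismProperty C) : Precoverage C where
  coverings X := {S | (∀ ⦃Y : C⦄ ⦃f : Y ⟶ X⦄, S f → O f) ∧ IsEpiSink S}

end Glutos

/-! ### Universal glutoses and nearly glutoses -/

/-- The category of continuous functors and all natural transformations between them. -/
abbrev ContinuousFunctor {C : Type w} [Category.{u} C] {D : Type w'} [Category.{v'} D]
    (τ : Precoverage C) (σ : Precoverage D) :=
  ObjectProperty.FullSubcategory (fun F : C ⥤ D => IsContinuous τ σ F)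

/-- Precomposition with a continuous functor. -/
def precomp {C : Type w} [Category.{u} C] {D : Type w'} [Category.{v'} D] {E : Type w''}
    [Category.{v''} E] {τ : Precoverage C} {σ : Precoverage D} (ρ : Precoverage E) (F : C ⥤ D)
    (hF : IsContinuous τ σ F) : ContinuousFunctor σ ρ ⥤ ContinuousFunctor τ ρ :=
  ObjectProperty.lift _ (ObjectProperty.ι _ ⋙ (Functor.whiskeringLeft C D E).obj F)
    (fun G => hF.comp G.property.map_mem G.property.map_isPullback)

/-- `Y : (P, τ) ⟶ (G, O)` makes the glutos `(G, O)` the universal glutos for the presite `(P, τ)`: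
for every glutos `(D, O')`, composition with `Y` is an equivalence from the category of continuous
functors `G ⥤ D` to the category of continuous functors `P ⥤ D`. -/
structure IsUniversalGlutos {P : Type (u + 1)} [LargeCategory P] (τ : Precoverage P)
    {G : Type (u + 1)} [LargeCategory G] (O : MorphismProperty G) (Y : P ⥤ G) : Prop where
  isGlutos : IsGlutos O
  isContinuous : IsContinuous τ (openEpi O) Y
  isEquivalence : ∀ (D : Type (u + 1)) [LargeCategory D] (O' : MorphismProperty D), IsGlutos O' →
    (precomp (openEpi O') Y isContinuous).IsEquivalence

/-- The presite `(C, τ)` is a nearly glutos: it has local small sets of generators, and there are a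
presite `(P, σ)` with local small sets of generators and a universal glutos `(G, O)` for it such
that `(C, τ)` is equivalent, as a presite, to `G` with the coverings that consist of
monomorphisms. -/
def IsNearlyGlutos {C : Type w} [Category.{u} C] (τ : Precoverage C) [IsPresite τ] : Prop :=
  HasLocalGenerators τ ∧
    ∃ (P : Type (u + 1)) (_ : LargeCategory P) (σ : Precoverage P)
      (G : Type (u + 1)) (_ : LargeCategory G) (O : MorphismProperty G) (Y : P ⥤ G) (e : C ≌ G),
      IsPresite σ ∧ HasLocalGenerators σ ∧ IsUniversalGlutos σ O Y ∧
        IsContinuous τ (monoPart (openEpi O)) e.functor ∧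
        IsContinuous (monoPart (openEpi O)) τ e.inverse

/-! ### Complete Heyting algebras and their sheaves -/

/-- The partially ordered set `α` is a complete Heyting algebra. -/
def IsCompleteHeyting (α : Type w) [PartialOrder α] : Prop :=
  ∃ F : Order.Frame α, ∀ a b : α, F.le a b ↔ a ≤ b

/-- The canonical topology of a partially ordered set: `S` covers `u` when every `v ≤ u` is the
least upper bound of the elements of `S` below `v`. In a complete Heyting algebra this says that
`u` is the supremum of `S`, see `mem_canonicalTopology_iff`. -/
def canonicalTopology (α : Type w) [PartialOrder α] : GrothendieckTopology α where
  sieves u := {S | ∀ v ≤ u, IsLUB {x | x ≤ v ∧ ∃ h : x ⟶ u, S h} v}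
  top_mem' u v hv := ⟨fun x hx => hx.1, fun b hb => hb ⟨le_rfl, homOfLE hv, trivial⟩⟩
  pullback_stable' u u' S f hS v hv := by
    refine ⟨fun x hx => hx.1, fun b hb => (hS v (hv.trans (leOfHom f))).2 ?_⟩
    rintro x ⟨hx, h, hS⟩
    refine hb ⟨hx, homOfLE (hx.trans hv), ?_⟩
    have e : homOfLE (hx.trans hv) ≫ f = h := Subsingleton.elim _ _
    simpa [Sieve.pullback_apply, e] using hS
  transitive' u S hS R hR v hv := by
    refine ⟨fun x hx => hx.1, fun b hb => (hS v hv).2 ?_⟩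
    rintro x ⟨hx, h, hSh⟩
    refine (hR hSh x le_rfl).2 ?_
    rintro y ⟨hy, k, hk⟩
    exact hb ⟨hy.trans hx, k ≫ h, hk⟩

theorem mem_canonicalTopology_iff (α : Type w) [Order.Frame α] (u : α) (S : Sieve u) :
    S ∈ canonicalTopology α u ↔ sSup {x | ∃ h : x ⟶ u, S h} = u := by
  constructor
  · intro h
    have h' := (h u le_rfl).sSup_eq
    refine le_antisymm (sSup_le fun x hx => leOfHom hx.choose) ?_
    conv_lhs => rw [← h']
    exact sSup_le_sSup fun x hx => hx.2
  · intro h v hv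
    refine ⟨fun x hx => hx.1, fun b hb => ?_⟩
    have e : v = v ⊓ sSup {x | ∃ h : x ⟶ u, S h} := by rw [h]; exact (inf_eq_left.2 hv).symm
    rw [e, inf_sSup_eq]
    refine iSup₂_le fun x hx => hb ⟨inf_le_left, ?_⟩
    obtain ⟨k, hk⟩ := hx
    exact ⟨homOfLE inf_le_right ≫ k, S.downward_closed hk _⟩

/-! ### Clopen subobjects, sections and gluing -/

section Sections

variable {C : Type w} [Category.{u} C] (τ : Precoverage C) [IsPresite τ] (X : C)

/-- The partially ordered set of clopen subobjects of `X`. -/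
abbrev ClopenSubobject : Type (max w u) := {P : Subobject X // clopen τ P.arrow}

/-- The full subcategory of the category of arrows over `X` formed by the locally clopen arrows. -/
abbrev LocallyClopenOver : Type (max w u) := (locallyClopen τ).Over ⊤ X

/-- The functor which sends a clopen subobject to a clopen arrow which represents it. -/
noncomputable def incl : ClopenSubobject τ X ⥤ LocallyClopenOver τ X where
  obj U := MorphismProperty.Over.mk ⊤ U.1.arrow (locallyClopen_of_clopen τ U.2)
  map {U V} h := MorphismProperty.Over.homMk (U.1.ofLE V.1 (leOfHom h)) (Subobject.ofLE_arrow _)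
  map_id U := by
    ext
    exact Subobject.ofLE_refl _
  map_comp f g := by
    ext
    exact (Subobject.ofLE_comp_ofLE _ _ _ _ _).symm

/-- The presheaf of sections of a locally clopen arrow over `X`: it sends a clopen subobject `U` of
`X` to the set of arrows over `X` from `U`. -/
noncomputable def sections : LocallyClopenOver τ X ⥤ (ClopenSubobject τ X)ᵒᵖ ⥤ Type u :=
  yoneda ⋙ (Functor.whiskeringLeft _ _ _).obj (incl τ X).op

/-- The category of sheaves of sets on the clopen subobjects of `X`. -/
abbrev Sh : Type (max w (u + 1)) :=
  Sheaf (canonicalTopology (ClopenSubobject τ X)) (Type u)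

variable {τ X}

/-- The pairs `⟨U, x⟩` of a clopen subobject `U` of `X` and an element `x` of `F(U)`. -/
def Index (F : (ClopenSubobject τ X)ᵒᵖ ⥤ Type u) : Type (max w u) :=
  Σ U : ClopenSubobject τ X, F.obj (op U)

/-- `⟨U, x⟩ ≤ ⟨V, y⟩` when `U ≤ V` and `x` is the restriction of `y` to `U`. -/
instance (F : (ClopenSubobject τ X)ᵒᵖ ⥤ Type u) : PartialOrder (Index F) where
  le i j := ∃ h : i.1 ≤ j.1, F.map (homOfLE h).op j.2 = i.2
  le_refl i := ⟨le_rfl, by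
    have : (homOfLE (le_refl i.1)).op = 𝟙 (op i.1) := rfl
    rw [this, F.map_id]; rfl⟩
  le_trans i j k := by
    rintro ⟨h, e⟩ ⟨h', e'⟩
    refine ⟨h.trans h', ?_⟩
    have : (homOfLE (h.trans h')).op = (homOfLE h').op ≫ (homOfLE h).op := rfl
    rw [this, F.map_comp, ← e, ← e']; rfl
  le_antisymm := by
    rintro ⟨U, x⟩ ⟨V, y⟩ ⟨h, e⟩ ⟨h', e'⟩
    obtain rfl : U = V := le_antisymm h h'
    have : (homOfLE h).op = 𝟙 (op U) := rfl
    rw [this, F.map_id] at e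
    have e : y = x := e
    rw [e]

/-- The gluing data of `F`: a copy of `U` for every index `⟨U, x⟩`, and, for every pair `i, j` of
indices with meet `k`, the subobject underlying `k` of the subobjects underlying `i` and `j`. -/
noncomputable def gluingData (F : (ClopenSubobject τ X)ᵒᵖ ⥤ Type u) :
    MultispanIndex
      { L := {p : Index F × Index F × Index F // IsGLB {p.1, p.2.1} p.2.2}
        R := Index F
        fst := fun p => p.1.1
        snd := fun p => p.1.2.1 }
      (LocallyClopenOver τ X) where
  left p := (incl τ X).obj p.1.2.2.1
  right i := (incl τ X).obj i.1
  fst p := (incl τ X).map (homOfLE (p.2.1 (by simp) : p.1.2.2 ≤ p.1.1).1)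
  snd p := (incl τ X).map (homOfLE (p.2.1 (by simp) : p.1.2.2 ≤ p.1.2.1).1)

theorem incl_map_comp_app {F : (ClopenSubobject τ X)ᵒᵖ ⥤ Type u} {E : LocallyClopenOver τ X}
    (a : F ⟶ (sections τ X).obj E) {i j : Index F} (h : i ≤ j) :
    (incl τ X).map (homOfLE h.1) ≫ (a.app (op j.1) j.2 : (incl τ X).obj j.1 ⟶ E) =
      (a.app (op i.1) i.2 : (incl τ X).obj i.1 ⟶ E) := by
  have := ConcreteCategory.congr_hom (a.naturality (homOfLE h.1).op) j.2
  rw [← h.2]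
  exact this.symm

/-- The cocone on the gluing data of `F` with vertex `E` which is given by a morphism from `F` to
the sections of `E`: its component at `⟨U, x⟩` is the section of `E` over `U` associated to `x`. -/
noncomputable def gluingCocone {F : (ClopenSubobject τ X)ᵒᵖ ⥤ Type u} {E : LocallyClopenOver τ X}
    (a : F ⟶ (sections τ X).obj E) : Multicofork (gluingData F) :=
  Multicofork.ofπ _ E (fun i => (a.app (op i.1) i.2 : (incl τ X).obj i.1 ⟶ E))
    (fun p => (incl_map_comp_app a (p.2.1 (by simp))).trans
      (incl_map_comp_app a (p.2.1 (by simp))).symm)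

end Sections

end Glutos

/-!
Transporting along the equivalence, one may work over an object of a glutos, with the coverings by
open monomorphisms. The open arrows to this object form a topos `E`, whose subterminal objects are
the open monomorphisms. The epimorphisms of `E` remain epi in the glutos, by effectiveness of
equivalence relations, so an arrow is locally clopen exactly when it is an object of `E` generated
by subterminal objects. What remains is the localic reflection of `E`, the topos of sheaves on the
frame `A` of subterminal objects.

If `E` is the category of sheaves on `(D, J)`, let `π d` be the support of `d`, that is, the image
in the terminal sheaf of the sheaf associated to `d`. The sections of a sheaf `P` over subterminal
objects form the right Kan extension of `P` along `π : D ⥤ A`. Its counit is locally injective,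
since a section over `π d` is locally determined by its values at `d`, and it is locally surjective
if and only if `P` is generated by subterminal objects. Therefore taking sections restricts to an
equivalence from the objects generated by subterminal objects to the sheaves on `A`.
-/

namespace Glutos

section ClosedClasses

variable {D : Type w} [Category.{v'} D] (J : GrothendieckTopology D)

/-- The sieve on `d` of the arrows whose source maps to some member of `K`. -/
def sourceSieve (K : Set D) (d : D) : Sieve d where
  arrows e _ := ∃ k ∈ K, Nonempty (e ⟶ k)
  downward_closed := by
    rintro _ _ _ ⟨k, hk, ⟨h⟩⟩ g
    exact ⟨k, hk, ⟨g ≫ h⟩⟩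

/-- The closure operator on classes of objects of the site `(D, J)` whose closed classes are the
subsheaves of the terminal sheaf, a subsheaf being encoded as the class of all objects over which it
has an element. The closure of `K` is the smallest such subsheaf with elements over `K`. -/
def localClosure : ClosureOperator (Set D) :=
  .mk₂ (fun K => {d | sourceSieve K d ∈ J d})
    (fun K d hd => J.superset_covering (fun e f _ => ⟨d, hd, ⟨f⟩⟩) (J.top_mem d))
    (fun K L h d hd => J.transitive hd _ (by
      rintro e f ⟨k, hk, ⟨g⟩⟩
      refine J.superset_covering ?_ (J.pullback_stable g (h hk))
      rintro c a ⟨l, hl, b⟩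
      exact ⟨l, hl, b⟩))

variable {J} {K : Set D}

theorem mem_localClosure_iff {d : D} : d ∈ localClosure J K ↔ sourceSieve K d ∈ J d := Iff.rfl

theorem mem_of_sieve (hK : (localClosure J).IsClosed K) {d : D} {S : Sieve d} (hS : S ∈ J d)
    (h : ∀ ⦃e : D⦄ (f : e ⟶ d), S f → e ∈ K) : d ∈ K := by
  rw [← hK.closure_eq, mem_localClosure_iff]
  exact J.superset_covering (fun e f hf => ⟨e, h f hf, ⟨𝟙 e⟩⟩) hS

theorem mem_of_hom (hK : (localClosure J).IsClosed K) {d e : D} (f : d ⟶ e) (he : e ∈ K) :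
    d ∈ K := by
  rw [← hK.closure_eq, mem_localClosure_iff]
  exact J.superset_covering (fun c g _ => ⟨e, he, ⟨g ≫ f⟩⟩) (J.top_mem d)

/-- The subpresheaf of the terminal presheaf with an element over the members of `K`. -/
def indicator (K : Set D) (hK : ∀ ⦃d e : D⦄, (d ⟶ e) → e ∈ K → d ∈ K) : Dᵒᵖ ⥤ Type u where
  obj d := ULift (PLift (d.unop ∈ K))
  map f := TypeCat.ofHom fun x => ⟨⟨hK f.unop x.down.down⟩⟩

instance (hK : ∀ ⦃d e : D⦄, (d ⟶ e) → e ∈ K → d ∈ K) (d : Dᵒᵖ) :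
    Subsingleton ((indicator.{w, v', u} K hK).obj d) :=
  inferInstanceAs (Subsingleton (ULift (PLift (d.unop ∈ K))))

theorem isSheaf_indicator (hK : (localClosure J).IsClosed K) :
    Presheaf.IsSheaf J (indicator.{w, v', u} K fun _ _ => mem_of_hom hK) :=
  (isSheaf_iff_isSheaf_of_type _ _).2 fun _ _ hS x _ =>
    ⟨⟨⟨mem_of_sieve hK hS fun _ f hf => (x f hf).down.down⟩⟩,
      fun _ _ _ => Subsingleton.elim _ _, fun _ _ => Subsingleton.elim _ _⟩

theorem nonempty_hom_of_subsingleton {P L : Dᵒᵖ ⥤ Type u} [∀ d, Subsingleton (L.obj d)]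
    (h : ∀ d, Nonempty (P.obj d) → Nonempty (L.obj d)) : Nonempty (P ⟶ L) :=
  ⟨{ app d := TypeCat.ofHom fun x => (h d ⟨x⟩).some
     naturality _ _ _ := by
      ext
      exact Subsingleton.elim _ _ }⟩

theorem subsingleton_hom_of_subsingleton {P L : Dᵒᵖ ⥤ Type u} [∀ d, Subsingleton (L.obj d)] :
    Subsingleton (P ⟶ L) where
  allEq f g := by
    ext d x
    exact Subsingleton.elim _ _

theorem nonempty_iso_of_subsingleton {P L : Dᵒᵖ ⥤ Type u} [∀ d, Subsingleton (P.obj d)]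
    [∀ d, Subsingleton (L.obj d)] (h : ∀ d, Nonempty (P.obj d) ↔ Nonempty (L.obj d)) :
    Nonempty (P ≅ L) :=
  ⟨{ hom := (nonempty_hom_of_subsingleton fun d => (h d).1).some
     inv := (nonempty_hom_of_subsingleton fun d => (h d).2).some
     hom_inv_id := subsingleton_hom_of_subsingleton.elim _ _
     inv_hom_id := subsingleton_hom_of_subsingleton.elim _ _ }⟩

theorem isSubterminal_of_subsingleton {L : Sheaf J (Type u)} [∀ d, Subsingleton (L.obj.obj d)] :
    IsSubterminal L := fun _ _ _ =>
  (sheafToPresheaf J _).map_injective ((subsingleton_hom_of_subsingleton (L := L.obj)).elim _ _)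

theorem isClosed_setOf_nonempty (L : Sheaf J (Type u)) [∀ d, Subsingleton (L.obj.obj d)] :
    (localClosure J).IsClosed {d | Nonempty (L.obj.obj (op d))} := by
  refine ClosureOperator.isClosed_iff_closure_le.2 fun d hd => ?_
  have hL : ∀ ⦃e : D⦄ (f : e ⟶ d), sourceSieve {d | Nonempty (L.obj.obj (op d))} d f →
      Nonempty (L.obj.obj (op e)) := fun e f ⟨_, ⟨x⟩, ⟨g⟩⟩ => ⟨L.obj.map g.op x⟩
  exact ⟨((isSheaf_iff_isSheaf_of_type _ _).1 L.property _ hd).amalgamate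
    (fun e f hf => (hL f hf).some) fun _ _ _ _ _ _ _ _ _ _ => Subsingleton.elim _ _⟩

theorem subsingleton_of_isSubterminal {D : Type u} [SmallCategory D] {J : GrothendieckTopology D}
    {L : Sheaf J (Type u)} (hL : IsSubterminal L) (d : Dᵒᵖ) : Subsingleton (L.obj.obj d) := by
  let e := ((sheafificationAdjunction J (Type u)).homEquiv (yoneda.obj d.unop) L).trans yonedaEquiv
  exact ⟨fun x y => e.symm.injective (hL _ _)⟩

end ClosedClasses

section Support

variable {D : Type w} [Category.{v'} D] {A : Type w'} [PartialOrder A]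

/-- `A` represents the partially ordered set of subsheaves of the terminal sheaf of the site
`(D, J)`, that is, of closed classes of objects: `a` corresponds to the class of all `d` such that
`π d ≤ a`. Then `π d` represents the smallest subsheaf which has an element over `d`. -/
structure IsSupport (J : GrothendieckTopology D) (π : D ⥤ A) : Prop where
  le_of_forall : ∀ a b : A, (∀ d, π.obj d ≤ a → π.obj d ≤ b) → a ≤ b
  isClosed_iff : ∀ K : Set D, (localClosure J).IsClosed K ↔ ∃ a, {d | π.obj d ≤ a} = K

variable {J : GrothendieckTopology D} {π : D ⥤ A}

namespace IsSupport

variable (hπ : IsSupport J π)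
include hπ

theorem isClosed_setOf_le (a : A) : (localClosure J).IsClosed {d | π.obj d ≤ a} :=
  (hπ.isClosed_iff _).2 ⟨a, rfl⟩

theorem sourceSieve_mem_of_le {d e : D} (h : π.obj d ≤ π.obj e) : sourceSieve {e} d ∈ J d := by
  obtain ⟨a, ha⟩ := (hπ.isClosed_iff _).1 ((localClosure J).isClosed_closure {e})
  have he : π.obj e ≤ a := ha.ge ((localClosure J).le_closure _ rfl)
  exact ha.le (h.trans he)

theorem exists_isLUB (s : Set A) :
    ∃ b, IsLUB s b ∧ {d | π.obj d ≤ b} = localClosure J {d | ∃ x ∈ s, π.obj d ≤ x} := by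
  obtain ⟨b, hb⟩ := (hπ.isClosed_iff _).1
    ((localClosure J).isClosed_closure {d | ∃ x ∈ s, π.obj d ≤ x})
  refine ⟨b, ⟨fun x hx => hπ.le_of_forall _ _ fun d hd => ?_, fun c hc => ?_⟩, hb⟩
  · exact hb.ge ((localClosure J).le_closure _ ⟨x, hx, hd⟩)
  · have hsc : {d | ∃ x ∈ s, π.obj d ≤ x} ⊆ {d | π.obj d ≤ c} :=
      fun d ⟨x, hx, hd⟩ => hd.trans (hc hx)
    exact hπ.le_of_forall _ _ fun d hd =>
      (localClosure J).closure_min hsc (hπ.isClosed_setOf_le c) (hb.le hd)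

theorem isCompleteHeyting : IsCompleteHeyting A := by
  choose sup hsup mem_sup using hπ.exists_isLUB
  let _ : SupSet A := ⟨sup⟩
  let L : CompleteLattice A := completeLatticeOfSup A hsup
  refine ⟨.ofMinimalAxioms { L with inf_sSup_le_iSup_inf := fun a s => ?_ }, fun _ _ => Iff.rfl⟩
  refine hπ.le_of_forall _ _ fun d hd => ?_
  have hds : sourceSieve {e | ∃ x ∈ s, π.obj e ≤ x} d ∈ J d :=
    (mem_sup s).le (hd.trans inf_le_right)
  refine mem_of_sieve (hπ.isClosed_setOf_le _) hds ?_
  rintro e f ⟨k, ⟨x, hx, hk⟩, ⟨g⟩⟩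
  have hea : π.obj e ≤ a := (leOfHom (π.map f)).trans (hd.trans inf_le_left)
  have hex : π.obj e ≤ x := (leOfHom (π.map g)).trans hk
  exact (le_inf hea hex).trans (le_iSup₂ (f := fun x _ => a ⊓ x) x hx)

theorem mem_canonicalTopology_iff {a : A} {S : Sieve a} :
    S ∈ canonicalTopology A a ↔
      ∀ (d : D) (hd : π.obj d ≤ a), (S.pullback (homOfLE hd)).functorPullback π ∈ J d := by
  constructor
  · intro hS d hd
    obtain ⟨b, hb, hbJ⟩ := hπ.exists_isLUB {x | x ≤ π.obj d ∧ ∃ h : x ⟶ a, S h}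
    refine J.superset_covering ?_ (hbJ.le ((hS _ hd).unique hb).le)
    rintro e f ⟨k, ⟨x, ⟨-, h, hx⟩, hk⟩, ⟨g⟩⟩
    exact S.downward_closed hx (homOfLE ((leOfHom (π.map g)).trans hk))
  · intro hS v hv
    refine ⟨fun x hx => hx.1, fun b hb => hπ.le_of_forall _ _ fun d hd => ?_⟩
    refine mem_of_sieve (hπ.isClosed_setOf_le b) (hS d (hd.trans hv)) fun e f hf => ?_
    exact hb ⟨(leOfHom (π.map f)).trans hd, _, hf⟩

theorem isCocontinuous : π.IsCocontinuous J (canonicalTopology A) where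
  cover_lift {d S} hS := by
    have := hπ.mem_canonicalTopology_iff.1 hS d le_rfl
    rwa [show homOfLE (le_refl (π.obj d)) = 𝟙 _ from rfl, Sieve.pullback_id] at this

end IsSupport

theorem IsSupport.small {D : Type u} [Category.{v'} D] {J : GrothendieckTopology D} {π : D ⥤ A}
    (hπ : IsSupport J π) : Small.{u} A :=
  small_of_injective (f := fun a => {d | π.obj d ≤ a}) fun _ _ h => le_antisymm
    (hπ.le_of_forall _ _ fun _ hd => h.le hd) (hπ.le_of_forall _ _ fun _ hd => h.ge hd)

variable (π) in
/-- The functor which sends `a` to the subpresheaf of the terminal presheaf on `D` with an element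
over all `d` such that `π d ≤ a`. -/
def support : A ⥤ Dᵒᵖ ⥤ Type u where
  obj a := indicator {d | π.obj d ≤ a} fun _ _ f h => (leOfHom (π.map f)).trans h
  map h := { app _ := TypeCat.ofHom fun x => ⟨⟨x.down.down.trans (leOfHom h)⟩⟩ }

instance (a : A) (d : Dᵒᵖ) : Subsingleton (((support.{w, w', v', u} π).obj a).obj d) :=
  inferInstanceAs (Subsingleton (ULift (PLift _)))

theorem isSheaf_support (hπ : IsSupport J π) (a : A) :
    Presheaf.IsSheaf J ((support.{w, w', v', u} π).obj a) :=
  isSheaf_indicator (hπ.isClosed_setOf_le a)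

theorem exists_isSupport {D : Type u} [SmallCategory D] {J : GrothendieckTopology D}
    (i : A ⥤ Sheaf J (Type u)) [i.Full] (hi : ∀ L, i.essImage L ↔ IsSubterminal L) :
    ∃ π : D ⥤ A, IsSupport J π ∧ Nonempty (support π ≅ i ⋙ sheafToPresheaf J _) := by
  have hsub (a : A) : ∀ d, Subsingleton ((i.obj a).obj.obj d) :=
    subsingleton_of_isSubterminal ((hi _).1 (i.obj_mem_essImage a))
  let N (a : A) : Set D := {d | Nonempty ((i.obj a).obj.obj (op d))}
  have closed (a : A) : (localClosure J).IsClosed (N a) := isClosed_setOf_nonempty _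
  have le_iff (a b : A) : a ≤ b ↔ N a ⊆ N b := by
    refine ⟨fun h d ⟨x⟩ => ⟨(i.map (homOfLE h)).hom.app _ x⟩, fun h => ?_⟩
    obtain ⟨f⟩ := nonempty_hom_of_subsingleton fun d => h (a := d.unop)
    exact leOfHom (i.preimage ⟨f⟩)
  have exists_eq (K : Set D) (hK : (localClosure J).IsClosed K) : ∃ a, N a = K := by
    obtain ⟨a, ⟨e⟩⟩ := (hi ⟨_, isSheaf_indicator hK⟩).2 isSubterminal_of_subsingleton
    refine ⟨a, Set.Subset.antisymm (fun d ⟨x⟩ => (e.hom.hom.app _ x).down.down) fun d hd => ?_⟩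
    exact ⟨e.inv.hom.app (op d) ⟨⟨hd⟩⟩⟩
  choose p hp using fun d : D => exists_eq _ ((localClosure J).isClosed_closure {d})
  have p_le_iff (d : D) (a : A) : p d ≤ a ↔ d ∈ N a := by
    rw [le_iff, hp]
    exact (closed a).closure_le_iff.trans Set.singleton_subset_iff
  let π : D ⥤ A :=
    { obj := p
      map f := homOfLE ((p_le_iff _ _).2 (mem_of_hom (closed _) f ((p_le_iff _ _).1 le_rfl))) }
  have setOf_le (a : A) : {d | π.obj d ≤ a} = N a := Set.ext fun d => p_le_iff d a
  refine ⟨π, ⟨fun a b h => (le_iff a b).2 ?_, fun K => ⟨fun hK => ?_, ?_⟩⟩, ?_⟩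
  · exact fun d hd => (p_le_iff d b).1 (h d ((p_le_iff d a).2 hd))
  · exact (exists_eq K hK).imp fun a ha => (setOf_le a).trans ha
  · rintro ⟨a, rfl⟩
    exact setOf_le a ▸ closed a
  · have iso (a : A) : Nonempty ((support π).obj a ≅ (i.obj a).obj) :=
      nonempty_iso_of_subsingleton fun d =>
        ⟨fun ⟨x⟩ => (p_le_iff _ _).1 x.down.down, fun hd => ⟨⟨⟨(p_le_iff _ _).2 hd⟩⟩⟩⟩
    exact ⟨NatIso.ofComponents (fun a => (iso a).some)
      fun {_ b} _ => (subsingleton_hom_of_subsingleton (L := (i.obj b).obj)).elim _ _⟩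

end Support

section Germs

/-- The functor which sends `t` to the presheaf `a ↦ Hom(i a, t)`. -/
abbrev restrictedYoneda {A : Type w'} [Category.{v'} A] {T : Type w} [Category.{u} T] (i : A ⥤ T) :
    T ⥤ Aᵒᵖ ⥤ Type u :=
  yoneda ⋙ (Functor.whiskeringLeft _ _ _).obj i.op

variable {D : Type u} [Category.{v'} D] {A : Type w'} [PartialOrder A] {π : D ⥤ A}
  {P : Dᵒᵖ ⥤ Type u}

/-- The value of a section over `a` at an object whose support lies below `a`. -/
def germ {a : A} (s : (support π).obj a ⟶ P) {d : D} (h : π.obj d ≤ a) : P.obj (op d) :=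
  s.app (op d) ⟨⟨h⟩⟩

theorem map_germ {a : A} (s : (support π).obj a ⟶ P) {d e : D} (f : e ⟶ d) (h : π.obj d ≤ a) :
    P.map f.op (germ s h) = germ s ((leOfHom (π.map f)).trans h) :=
  (NatTrans.naturality_apply s f.op ⟨⟨h⟩⟩).symm

@[ext]
theorem germ_ext {a : A} {s t : (support π).obj a ⟶ P}
    (h : ∀ (d : D) (hd : π.obj d ≤ a), germ s hd = germ t hd) : s = t := by
  ext ⟨d⟩ ⟨⟨hd⟩⟩
  exact h d hd

variable (π P) in
/-- The evaluation of sections over the support of an object at this object: the counit of the right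
Kan extension of `P` along `π`. -/
def germHom : π.op ⋙ (restrictedYoneda (support π)).obj P ⟶ P where
  app d := TypeCat.ofHom fun s => germ (a := π.obj d.unop) s le_rfl
  naturality d e f := by
    ext s
    exact (map_germ (a := π.obj d.unop) s f.unop le_rfl).symm

variable (π P) in
/-- A section over `a` is a compatible family of values at the objects `d` such that `π d ≤ a`. -/
def isPointwiseRightKanExtensionGermHom :
    (Functor.RightExtension.mk _ (germHom π P)).IsPointwiseRightKanExtension := fun a =>
  { lift c := TypeCat.ofHom fun x =>
      { app d := TypeCat.ofHom fun h =>
          c.π.app (StructuredArrow.mk (f := (homOfLE h.down.down).op) (T := π.op)) x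
        naturality d e f := by
          ext h
          let u : StructuredArrow.mk (homOfLE h.down.down).op ⟶ StructuredArrow.mk (T := π.op)
            (homOfLE ((leOfHom (π.map f.unop)).trans h.down.down)).op := StructuredArrow.homMk f
          exact (ConcreteCategory.congr_hom (c.w u) x).symm }
    fac c d := by
      ext x
      rfl
    uniq c m hm := by
      ext x
      refine germ_ext fun d hd => ?_
      exact ConcreteCategory.congr_hom
        (hm (StructuredArrow.mk (f := (homOfLE hd).op) (T := π.op))) x }

instance : ((restrictedYoneda (support π)).obj P).IsRightKanExtension (germHom π P) :=
  (isPointwiseRightKanExtensionGermHom π P).isRightKanExtension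

end Germs

section Sections

variable {D : Type u} [SmallCategory D] {J : GrothendieckTopology D} {A : Type w'} [PartialOrder A]
  {π : D ⥤ A}

namespace IsSupport

variable (hπ : IsSupport J π)
include hπ

theorem isSheaf_restrictedYoneda {P : Dᵒᵖ ⥤ Type u} (hP : Presheaf.IsSheaf J P) :
    Presheaf.IsSheaf (canonicalTopology A) ((restrictedYoneda (support π)).obj P) := by
  have := hπ.isCocontinuous
  exact (Presheaf.isSheaf_iff_multifork _ _).2 fun a S =>
    ⟨RanIsSheafOfIsCocontinuous.isLimitMultifork hP
      (isPointwiseRightKanExtensionGermHom π P) S⟩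

/-- The direct image of sheaves along the localic reflection of the sheaf topos of `(D, J)`. -/
def sections : Sheaf J (Type u) ⥤ Sheaf (canonicalTopology A) (Type u) :=
  ObjectProperty.lift _ (sheafToPresheaf J _ ⋙ restrictedYoneda (support π))
    fun P => hπ.isSheaf_restrictedYoneda P.property

theorem isLocallyInjective_germHom {P : Dᵒᵖ ⥤ Type u} (hP : Presieve.IsSeparated J P) :
    Presheaf.IsLocallyInjective J (germHom π P) := by
  refine Presheaf.isLocallyInjective_of_injective J _ fun d s t hst => germ_ext fun e he => ?_
  refine (hP _ (hπ.sourceSieve_mem_of_le he)).ext ?_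
  rintro c f ⟨_, rfl, ⟨g⟩⟩
  have hg : germ (a := π.obj d.unop) s le_rfl = germ t le_rfl := hst
  rw [map_germ, map_germ, ← map_germ s g le_rfl, ← map_germ t g le_rfl, hg]

theorem exists_iso_support {L : Sheaf J (Type u)} (hL : IsSubterminal L) :
    ∃ a, Nonempty ((support π).obj a ≅ L.obj) := by
  have := subsingleton_of_isSubterminal hL
  obtain ⟨a, ha⟩ := (hπ.isClosed_iff _).1 (isClosed_setOf_nonempty L)
  exact ⟨a, nonempty_iso_of_subsingleton fun d =>
    ⟨fun ⟨x⟩ => ha.le x.down.down, fun hd => ⟨⟨⟨ha.ge hd⟩⟩⟩⟩⟩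

theorem germHom_comp_eq_iff {P Q : Sheaf J (Type u)} (f g : P ⟶ Q) :
    germHom π P.obj ≫ f.hom = germHom π P.obj ≫ g.hom ↔
      ∀ ⦃L : Sheaf J (Type u)⦄, IsSubterminal L → ∀ s : L ⟶ P, s ≫ f = s ≫ g := by
  constructor
  · intro h L hL s
    obtain ⟨a, ⟨e⟩⟩ := hπ.exists_iso_support hL
    refine (sheafToPresheaf J _).map_injective ((cancel_epi e.hom).1 (germ_ext fun d hd => ?_))
    let t : (support π).obj (π.obj d) ⟶ P.obj := (support π).map (homOfLE hd) ≫ e.hom ≫ s.hom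
    exact congrArg (fun φ => φ.app (op d) t) h
  · intro h
    ext d s
    have h := h (L := ⟨_, isSheaf_support hπ (π.obj d.unop)⟩) isSubterminal_of_subsingleton ⟨s⟩
    exact congrArg (fun φ => φ.hom.app d ⟨⟨le_rfl⟩⟩) h

end IsSupport

end Sections

section Generated

/-- The objects which are generated by subterminal objects: the morphisms to them from subterminal
objects are jointly epimorphic. -/
def IsSubterminalGenerated {E : Type w} [Category.{v'} E] (P : E) : Prop :=
  ∀ ⦃Q : E⦄ (f g : P ⟶ Q), (∀ ⦃L : E⦄, IsSubterminal L → ∀ s : L ⟶ P, s ≫ f = s ≫ g) → f = g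

variable {D : Type u} [SmallCategory D] {J : GrothendieckTopology D} {A : Type w'} [PartialOrder A]
  {π : D ⥤ A} {F G : Aᵒᵖ ⥤ Type u}

namespace IsSupport

variable (hπ : IsSupport J π)
include hπ

/-- Both sides say that the morphism from the sheaf associated to the presheaf of sections over
supports is epi. -/
theorem isLocallySurjective_germHom_iff (P : Sheaf J (Type u)) :
    Presheaf.IsLocallySurjective J (germHom π P.obj) ↔ IsSubterminalGenerated P := by
  let φ : (presheafToSheaf J (Type u)).obj _ ⟶ P := ⟨sheafifyLift J (germHom π P.obj) P.property⟩
  have fac : toSheafify J _ ≫ φ.hom = germHom π P.obj := toSheafify_sheafifyLift _ _ _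
  have cancel {Q : Sheaf J (Type u)} (f g : P ⟶ Q) : φ ≫ f = φ ≫ g ↔
      ∀ ⦃L : Sheaf J (Type u)⦄, IsSubterminal L → ∀ s : L ⟶ P, s ≫ f = s ≫ g := by
    rw [← hπ.germHom_comp_eq_iff, ← fac, Category.assoc, Category.assoc]
    exact ⟨fun h => congrArg (fun k => toSheafify J _ ≫ k.hom) h,
      fun h => (sheafToPresheaf J _).map_injective (sheafify_hom_ext J _ _ Q.property h)⟩
  calc Presheaf.IsLocallySurjective J (germHom π P.obj)
    _ ↔ Sheaf.IsLocallySurjective φ := by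
      rw [← fac]
      exact Presheaf.comp_isLocallySurjective_iff J _ _
    _ ↔ Epi φ := Sheaf.isLocallySurjective_iff_epi' (A := Type u) φ
    _ ↔ IsSubterminalGenerated P :=
      ⟨fun _ _ f g h => (cancel_epi φ).1 ((cancel f g).2 h),
        fun h => ⟨fun f g hfg => h f g ((cancel f g).1 hfg)⟩⟩

theorem W_germHom {P : Sheaf J (Type u)} (hP : IsSubterminalGenerated P) :
    J.W (germHom π P.obj) :=
  (J.W_iff_isLocallyBijective _).2
    ⟨hπ.isLocallyInjective_germHom ((isSheaf_iff_isSheaf_of_type _ _).1 P.property).isSeparated,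
      (hπ.isLocallySurjective_germHom_iff P).2 hP⟩

theorem sections_map_bijective {P : Sheaf J (Type u)} (hP : IsSubterminalGenerated P)
    (Q : Sheaf J (Type u)) : Function.Bijective (hπ.sections.map : (P ⟶ Q) → _) := by
  let adjunct (g : hπ.sections.obj P ⟶ hπ.sections.obj Q) :=
    Functor.whiskerLeft π.op g.hom ≫ germHom π Q.obj
  have adjunct_bijective : Function.Bijective adjunct :=
    (Functor.homEquivOfIsRightKanExtension _ (germHom π Q.obj) _).bijective.comp
      (fullyFaithfulSheafToPresheaf _ _).homEquiv.bijective
  refine (Function.Bijective.of_comp_iff' adjunct_bijective _).1 ?_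
  exact ((hπ.W_germHom hP) Q.obj Q.property).comp
    (fullyFaithfulSheafToPresheaf J _).homEquiv.bijective

theorem isLocallyInjective_of_whiskerLeft (f : F ⟶ G)
    [Presheaf.IsLocallyInjective J (Functor.whiskerLeft π.op f)] :
    Presheaf.IsLocallyInjective (canonicalTopology A) f where
  equalizerSieve_mem {a} x y h := by
    refine hπ.mem_canonicalTopology_iff.2 fun d hd => ?_
    have hxy : f.app (op (π.obj d)) (F.map (homOfLE hd).op x) =
        f.app (op (π.obj d)) (F.map (homOfLE hd).op y) := by
      rw [NatTrans.naturality_apply, NatTrans.naturality_apply, h]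
    refine J.superset_covering ?_
      (Presheaf.equalizerSieve_mem J (Functor.whiskerLeft π.op f) (X := op d) _ _ hxy)
    intro e g hg
    simpa [Presheaf.equalizerSieve] using! hg

theorem isLocallySurjective_of_whiskerLeft (f : F ⟶ G)
    [Presheaf.IsLocallySurjective J (Functor.whiskerLeft π.op f)] :
    Presheaf.IsLocallySurjective (canonicalTopology A) f where
  imageSieve_mem {a} x := by
    refine hπ.mem_canonicalTopology_iff.2 fun d hd => ?_
    refine J.superset_covering ?_ (Presheaf.imageSieve_mem J (Functor.whiskerLeft π.op f)
      (U := op d) (G.map (homOfLE hd).op x))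
    rintro e g ⟨y, hy⟩
    exact ⟨y, by simpa using! hy⟩

theorem exists_isSubterminalGenerated_sections_iso
    (F : Sheaf (canonicalTopology A) (Type u)) :
    ∃ P, IsSubterminalGenerated P ∧ Nonempty (hπ.sections.obj P ≅ F) := by
  let P := (presheafToSheaf J (Type u)).obj (π.op ⋙ F.obj)
  let η : π.op ⋙ F.obj ⟶ P.obj := toSheafify J _
  let lift : F.obj ⟶ (restrictedYoneda (support π)).obj P.obj :=
    Functor.liftOfIsRightKanExtension _ (germHom π P.obj) _ η
  let φ : F ⟶ hπ.sections.obj P := ⟨lift⟩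
  have fac : Functor.whiskerLeft π.op φ.hom ≫ germHom π P.obj = η :=
    Functor.liftOfIsRightKanExtension_fac ((restrictedYoneda (support π)).obj P.obj) _ _ _
  have hη : J.W η := J.W_toSheafify _
  have hP : IsSubterminalGenerated P := by
    have := hη.isLocallySurjective
    exact (hπ.isLocallySurjective_germHom_iff P).1
      (Presheaf.isLocallySurjective_of_isLocallySurjective_fac J fac)
  have hφ : J.W (Functor.whiskerLeft π.op φ.hom) :=
    J.W.of_postcomp _ _ (hπ.W_germHom hP) (fac ▸ hη)
  have := hφ.isLocallyInjective
  have := hφ.isLocallySurjective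
  have : IsIso φ := (Sheaf.isLocallyBijective_iff_isIso _).1
    ⟨hπ.isLocallyInjective_of_whiskerLeft φ.hom, hπ.isLocallySurjective_of_whiskerLeft φ.hom⟩
  exact ⟨P, hP, ⟨(asIso φ).symm⟩⟩

end IsSupport

end Generated

section Transfer

variable {E : Type w} [Category.{v'} E] {E' : Type w''} [Category.{v''} E']

theorem isSubterminal_of_mono {K L : E} (m : K ⟶ L) [Mono m] (hL : IsSubterminal L) :
    IsSubterminal K := fun _ f g => (cancel_mono m).1 (hL (f ≫ m) (g ≫ m))

theorem isSubterminal_rightAdjoint_obj {F : E ⥤ E'} {R : E' ⥤ E} (adj : F ⊣ R) {L : E'}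
    (hL : IsSubterminal L) : IsSubterminal (R.obj L) := fun _ _ _ =>
  (adj.homEquiv _ _).symm.injective (hL _ _)

theorem isSubterminal_inverse_obj_iff (e : E ≌ E') {L : E'} :
    IsSubterminal (e.inverse.obj L) ↔ IsSubterminal L :=
  ⟨fun h => isSubterminal_of_mono (e.counitInv.app L)
      (isSubterminal_rightAdjoint_obj e.symm.toAdjunction h),
    isSubterminal_rightAdjoint_obj e.toAdjunction⟩

theorem IsSubterminalGenerated.of_epi {P Q : E} (p : P ⟶ Q) [Epi p]
    (hP : IsSubterminalGenerated P) : IsSubterminalGenerated Q := fun _ f g h =>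
  (cancel_epi p).1 (hP _ _ fun _ hL s => by simpa only [Category.assoc] using h hL (s ≫ p))

theorem IsSubterminalGenerated.leftAdjoint_obj {F : E ⥤ E'} {R : E' ⥤ E} (adj : F ⊣ R)
    (hF : ∀ ⦃L : E⦄, IsSubterminal L → IsSubterminal (F.obj L)) {P : E}
    (hP : IsSubterminalGenerated P) : IsSubterminalGenerated (F.obj P) := fun _ f g h =>
  (adj.homEquiv _ _).injective (hP _ _ fun _ hL s => by
    rw [← adj.homEquiv_naturality_left, ← adj.homEquiv_naturality_left, h (hF hL)])

theorem isSubterminalGenerated_inverse_obj_iff (e : E ≌ E') {P : E'} :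
    IsSubterminalGenerated (e.inverse.obj P) ↔ IsSubterminalGenerated P :=
  ⟨fun h => (h.leftAdjoint_obj e.toAdjunction fun _ =>
      isSubterminal_rightAdjoint_obj e.symm.toAdjunction).of_epi (e.counit.app P),
    fun h => h.leftAdjoint_obj e.symm.toAdjunction fun _ =>
      isSubterminal_rightAdjoint_obj e.toAdjunction⟩

theorem essImage_comp_functor_iff {T : Type w'} [Category.{u} T] (Φ : T ⥤ E) (e : E ≌ E') (Q : E') :
    (Φ ⋙ e.functor).essImage Q ↔ Φ.essImage (e.inverse.obj Q) :=
  exists_congr fun t => ⟨fun ⟨k⟩ => ⟨e.unitIso.app (Φ.obj t) ≪≫ e.inverse.mapIso k⟩,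
    fun ⟨k⟩ => ⟨e.functor.mapIso k ≪≫ e.counitIso.app Q⟩⟩

end Transfer

section Representation

variable {A : Type w'} [PartialOrder A] {T : Type w} [Category.{u} T]

theorem nonempty_restrictedYoneda_iso {D : Type u} [SmallCategory D] {J : GrothendieckTopology D}
    {i : A ⥤ T} {Φ : T ⥤ Sheaf J (Type u)} (hΦ : Φ.FullyFaithful) {π : D ⥤ A}
    (σ : support π ≅ (i ⋙ Φ) ⋙ sheafToPresheaf J _) :
    Nonempty (restrictedYoneda i ≅ Φ ⋙ sheafToPresheaf J _ ⋙ restrictedYoneda (support π)) :=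
  ⟨NatIso.ofComponents
    (fun t => NatIso.ofComponents
      (fun a => ((hΦ.comp (fullyFaithfulSheafToPresheaf J _)).homEquiv.trans
        (σ.app a.unop).symm.homFromEquiv).toIso)
      fun {a b} f => by
        ext s
        have := σ.hom.naturality f.unop
        change σ.hom.app _ ≫ (Φ.map (i.map f.unop ≫ s)).hom =
          (support π).map f.unop ≫ σ.hom.app _ ≫ (Φ.map s).hom
        rw [reassoc_of% this]
        simp)
    fun {s t} f => by
      ext a g
      change σ.hom.app _ ≫ (Φ.map (g ≫ f)).hom = (σ.hom.app _ ≫ (Φ.map g).hom) ≫ (Φ.map f).hom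
      simp⟩

theorem IsSupport.isEquivalence_comp_sections {D : Type u} [SmallCategory D]
    {J : GrothendieckTopology D} {π : D ⥤ A} (hπ : IsSupport J π) (Φ : T ⥤ Sheaf J (Type u))
    [Φ.Full] [Φ.Faithful] (hΦ : ∀ P, Φ.essImage P ↔ IsSubterminalGenerated P) :
    (Φ ⋙ hπ.sections).IsEquivalence where
  faithful := ⟨fun h =>
    Φ.map_injective ((hπ.sections_map_bijective ((hΦ _).1 (Φ.obj_mem_essImage _)) _).1 h)⟩
  full := ⟨fun g => by
    obtain ⟨f, rfl⟩ := (hπ.sections_map_bijective ((hΦ _).1 (Φ.obj_mem_essImage _)) _).2 g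
    exact ⟨Φ.preimage f, congrArg hπ.sections.map (Φ.map_preimage f)⟩⟩
  essSurj := ⟨fun F => by
    obtain ⟨P, hP, ⟨k⟩⟩ := hπ.exists_isSubterminalGenerated_sections_iso F
    obtain ⟨t, ⟨l⟩⟩ := (hΦ P).2 hP
    exact ⟨t, ⟨hπ.sections.mapIso l ≪≫ k⟩⟩⟩

theorem exists_equivalence_sheaf {E : Type w''} [Category.{v''} E] (hE : IsTopos.{w'', v'', u} E)
    (i : A ⥤ T) [i.Full] (Φ : T ⥤ E) [Φ.Full] [Φ.Faithful]
    (hi : ∀ P, (i ⋙ Φ).essImage P ↔ IsSubterminal P)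
    (hΦ : ∀ P, Φ.essImage P ↔ IsSubterminalGenerated P) :
    Small.{u} A ∧ IsCompleteHeyting A ∧ ∃ e : T ≌ Sheaf (canonicalTopology A) (Type u),
      Nonempty (e.functor ⋙ sheafToPresheaf _ _ ≅ restrictedYoneda i) := by
  obtain ⟨D, _, J, ⟨e⟩⟩ := hE
  let Ψ := Φ ⋙ e.functor
  have hΨ (P : Sheaf J (Type u)) : Ψ.essImage P ↔ IsSubterminalGenerated P := by
    rw [essImage_comp_functor_iff, hΦ, isSubterminalGenerated_inverse_obj_iff]
  have hiΨ (P : Sheaf J (Type u)) : (i ⋙ Ψ).essImage P ↔ IsSubterminal P :=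
    (essImage_comp_functor_iff (i ⋙ Φ) e P).trans
      ((hi _).trans (isSubterminal_inverse_obj_iff e))
  obtain ⟨π, hπ, ⟨σ⟩⟩ := exists_isSupport (i ⋙ Ψ) hiΨ
  have := hπ.isEquivalence_comp_sections Ψ hΨ
  obtain ⟨κ⟩ := nonempty_restrictedYoneda_iso (.ofFullyFaithful Ψ) σ
  exact ⟨hπ.small, hπ.isCompleteHeyting, (Ψ ⋙ hπ.sections).asEquivalence, ⟨κ.symm⟩⟩

end Representation

section SheavesOnPoset

variable {A : Type w'} [o : PartialOrder A]

theorem isTopos_sheaf_canonicalTopology (A : Type w') [PartialOrder A] [Small.{u} A] :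
    IsTopos.{max w' (u + 1), max w' u, u} (Sheaf (canonicalTopology A) (Type u)) := by
  have : LocallySmall.{u} A := ⟨fun a b => small_of_injective (β := PUnit) (f := fun _ => ⟨⟩)
    fun _ _ _ => Subsingleton.elim _ _⟩
  have := essentiallySmall_of_small_of_locallySmall A
  exact ⟨SmallModel.{u} A, inferInstance, _, ⟨(equivSmallModel A).sheafCongr _
    ((equivSmallModel A).inverse.inducedTopology (canonicalTopology A)) _⟩⟩

theorem isClosed_Iic (a : A) : (localClosure (canonicalTopology A)).IsClosed (Set.Iic a) :=
  ClosureOperator.isClosed_iff_closure_le.2 fun b hb =>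
    (hb b le_rfl).2 fun _ ⟨_, _, _, hc, ⟨h⟩⟩ => (leOfHom h).trans hc

theorem isSeparating_isSubterminal (A : Type w') [PartialOrder A] :
    ObjectProperty.IsSeparating
      (fun F : Sheaf (canonicalTopology A) (Type u) => IsSubterminal F) := by
  intro F G f g h
  ext ⟨a⟩ x
  let K : Sheaf (canonicalTopology A) (Type u) := ⟨_, isSheaf_indicator (isClosed_Iic a)⟩
  let s : K ⟶ F := ⟨
    { app b := TypeCat.ofHom fun k => F.obj.map (homOfLE k.down.down).op x
      naturality b c k := by
        ext ⟨⟨hb⟩⟩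
        exact Functor.map_comp_apply F.obj (homOfLE hb).op k x }⟩
  have hs : s.hom.app (op a) ⟨⟨le_rfl⟩⟩ = x := F.obj.map_id_apply _ x
  have := congrArg (fun φ => φ.hom.app (op a) ⟨⟨le_rfl⟩⟩) (h K isSubterminal_of_subsingleton s)
  rw [← hs]
  exact this

theorem IsCompleteHeyting.exists_isLUB (hA : IsCompleteHeyting A) (s : Set A) :
    ∃ a, IsLUB s a := by
  obtain ⟨L, hL⟩ := hA
  obtain rfl : L.toPartialOrder = o := PartialOrder.ext hL
  exact ⟨sSup s, isLUB_sSup s⟩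

theorem IsCompleteHeyting.mem_canonicalTopology (hA : IsCompleteHeyting A)
    {a : A} {S : Sieve a} (hS : IsLUB {x | ∃ h : x ⟶ a, S h} a) : S ∈ canonicalTopology A a := by
  obtain ⟨L, hL⟩ := hA
  obtain rfl : L.toPartialOrder = o := PartialOrder.ext hL
  exact (mem_canonicalTopology_iff A a S).2 hS.sSup_eq

end SheavesOnPoset

section Gluing

variable {C : Type w} [Category.{u} C] {τ : Precoverage C} {X : C}

/-- The meet of two indices lives over the largest clopen subobject on which they agree. -/
theorem exists_isGLB_index (hA : IsCompleteHeyting (ClopenSubobject τ X)) (F : Sh τ X)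
    (i j : Index F.obj) : ∃ k, IsGLB {i, j} k := by
  obtain ⟨U, x⟩ := i
  obtain ⟨V, y⟩ := j
  let agree : Set (ClopenSubobject τ X) :=
    {W | ∃ (h : W ≤ U) (h' : W ≤ V), F.obj.map (homOfLE h).op x = F.obj.map (homOfLE h').op y}
  obtain ⟨W, hW⟩ := hA.exists_isLUB agree
  have hWU : W ≤ U := hW.2 fun _ h => h.1
  have hWV : W ≤ V := hW.2 fun _ h => h.2.1
  let xW := F.obj.map (homOfLE hWU).op x
  let yW := F.obj.map (homOfLE hWV).op y
  have hS : Presheaf.equalizerSieve (F := F.obj) (X := op W) xW yW ∈ canonicalTopology _ W := by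
    refine hA.mem_canonicalTopology ⟨fun _ ⟨h, _⟩ => leOfHom h, fun b hb => hW.2 fun c hc => ?_⟩
    refine hb ⟨homOfLE (hW.1 hc), ?_⟩
    obtain ⟨h, h', hxy⟩ := hc
    change F.obj.map _ (F.obj.map _ x) = F.obj.map _ (F.obj.map _ y)
    rw [← Functor.map_comp_apply, ← Functor.map_comp_apply]
    exact hxy
  have hxy : xW = yW :=
    (((isSheaf_iff_isSheaf_of_type _ _).1 F.property _ hS).isSeparatedFor.ext fun _ _ h => h)
  refine ⟨⟨W, xW⟩, ?_, ?_⟩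
  · rintro _ (rfl | rfl)
    · exact ⟨hWU, rfl⟩
    · exact ⟨hWV, hxy.symm⟩
  · rintro ⟨c, z⟩ hc
    obtain ⟨hcU, hx⟩ := hc (Set.mem_insert _ _)
    obtain ⟨hcV, hy⟩ := hc (Set.mem_insert_of_mem _ rfl)
    refine ⟨hW.1 ⟨hcU, hcV, hx.trans hy.symm⟩, Eq.trans ?_ hx⟩
    exact (Functor.map_comp_apply _ _ _ _).symm

variable [IsPresite τ] {F : (ClopenSubobject τ X)ᵒᵖ ⥤ Type u}

theorem map_comp_multicofork_π (K : Multicofork (gluingData F)) {i j : Index F} (h : i ≤ j) :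
    (incl τ X).map (homOfLE h.1) ≫ K.π j = K.π i := by
  have hi : IsGLB {i, j} i :=
    ⟨by rintro _ (rfl | rfl); exacts [le_rfl, h], fun k hk => hk (Set.mem_insert _ _)⟩
  have hK : (incl τ X).map (homOfLE h.1) ≫ K.π j =
      (incl τ X).map (homOfLE (le_refl i.1)) ≫ K.π i := (K.condition ⟨(i, j, i), hi⟩).symm
  exact hK.trans ((congrArg (· ≫ K.π i) ((incl τ X).map_id i.1)).trans (Category.id_comp _))

/-- The morphism to the sections of the vertex of a cocone on the gluing data of `F` whose values
are the components of the cocone. This is the inverse construction to `gluingCocone`. -/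
noncomputable def homOfMulticofork (K : Multicofork (gluingData F)) :
    F ⟶ (sections τ X).obj K.pt where
  app U := TypeCat.ofHom fun x => K.π (⟨U.unop, x⟩ : Index F)
  naturality U V f := by
    ext x
    exact (map_comp_multicofork_π K (i := ⟨V.unop, F.map f x⟩) (j := ⟨U.unop, x⟩)
      ⟨leOfHom f.unop, rfl⟩).symm

theorem nonempty_isColimit_gluingCocone [(sections τ X).Full] [(sections τ X).Faithful]
    {E : LocallyClopenOver τ X} (a : F ⟶ (sections τ X).obj E) [IsIso a] :
    Nonempty (IsColimit (gluingCocone a)) := by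
  let desc (K : Multicofork (gluingData F)) : E ⟶ K.pt :=
    (sections τ X).preimage (inv a ≫ homOfMulticofork K)
  have fac (K : Multicofork (gluingData F)) :
      a ≫ (sections τ X).map (desc K) = homOfMulticofork K := by
    rw [Functor.map_preimage, IsIso.hom_inv_id_assoc]
  refine ⟨Multicofork.IsColimit.mk _ desc (fun K i => ?_) fun K m hm => ?_⟩
  · exact congrArg (fun φ => φ.app (op i.1) i.2) (fac K)
  · refine (sections τ X).map_injective ((cancel_epi a).1 (Eq.trans ?_ (fac K).symm))
    ext U x
    exact hm ⟨U.unop, x⟩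

end Gluing

section Topos

variable {E : Type w} [Category.{v'} E]

theorem IsTopos.exists_small_subterminals (hE : IsTopos.{w, v', u} E) :
    ∃ (ι : Type u) (K : ι → E), (∀ i, IsSubterminal (K i)) ∧
      ∀ L : E, IsSubterminal L → ∃ i, Nonempty (K i ≅ L) := by
  obtain ⟨D, _, J, ⟨e⟩⟩ := hE
  refine ⟨{K : Set D // (localClosure J).IsClosed K},
    fun K => e.inverse.obj ⟨_, isSheaf_indicator K.2⟩,
    fun K => (isSubterminal_inverse_obj_iff e).2 isSubterminal_of_subsingleton, fun L hL => ?_⟩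
  have (d : Dᵒᵖ) : Subsingleton ((e.functor.obj L).obj.obj d) := subsingleton_of_isSubterminal
    (isSubterminal_rightAdjoint_obj e.symm.toAdjunction hL) d
  obtain ⟨k⟩ := nonempty_iso_of_subsingleton
    (P := indicator _ fun _ _ => mem_of_hom (isClosed_setOf_nonempty (e.functor.obj L)))
    (L := (e.functor.obj L).obj) fun d => ⟨fun ⟨x⟩ => x.down.down, fun hd => ⟨⟨⟨hd⟩⟩⟩⟩
  exact ⟨⟨_, isClosed_setOf_nonempty (e.functor.obj L)⟩,
    ⟨e.inverse.mapIso ((fullyFaithfulSheafToPresheaf J _).preimageIso k) ≪≫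
      (e.unitIso.app L).symm⟩⟩

theorem IsTopos.effectiveEpi (hE : IsTopos.{w, v', u} E) {P Q : E} (p : P ⟶ Q) [Epi p] :
    EffectiveEpi p := by
  obtain ⟨D, _, J, ⟨e⟩⟩ := hE
  have : IsRegularEpi (e.functor.map p) := ⟨⟨regularEpiOfEpi _⟩⟩
  exact e.functor.effectiveEpi_of_map p inferInstance

end Topos

section OpenArrows

variable {G : Type w} [Category.{u} G] {O : MorphismProperty G}

theorem clopen_monoPart_iff [O.ContainsIdentities] {U X : G} (f : U ⟶ X) :
    clopen (monoPart (openEpi O)) f ↔ O f ∧ Mono f := by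
  refine ⟨fun ⟨S, hS, hf⟩ => ⟨hS.1.1 hf, hS.2 hf⟩, fun ⟨hf, hf'⟩ => ?_⟩
  refine ⟨.singleton f ⊔ .singleton (𝟙 X), ⟨⟨?_, ?_⟩, ?_⟩, Or.inl ⟨⟩⟩
  · rintro _ _ (⟨⟨⟩⟩ | ⟨⟨⟩⟩)
    exacts [hf, O.id_mem X]
  · exact fun Z a b h => by simpa using h (f := 𝟙 X) (Or.inr ⟨⟩)
  · rintro _ _ (⟨⟨⟩⟩ | ⟨⟨⟩⟩)
    exacts [hf', inferInstance]

theorem isSubterminal_iff_mono [IsClopos O] {X : G} (P : O.Over ⊤ X) :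
    IsSubterminal P ↔ Mono P.hom := by
  constructor
  · intro h
    have := IsClopos.hasPullback P.hom P.hom P.prop
    let K : O.Over ⊤ X := MorphismProperty.Over.mk ⊤ (pullback.fst P.hom P.hom ≫ P.hom)
      (O.comp_mem _ _ (O.pullback_fst _ _ P.prop) P.prop)
    have hK := h (Z := K) (MorphismProperty.Over.homMk (pullback.fst P.hom P.hom))
      (MorphismProperty.Over.homMk (pullback.snd P.hom P.hom) pullback.condition.symm)
    have fst_eq_snd : pullback.fst P.hom P.hom = pullback.snd P.hom P.hom :=
      congrArg (fun k : K ⟶ P => k.left) hK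
    refine ⟨fun {Z} a b hab => ?_⟩
    rw [← pullback.lift_fst a b hab, fst_eq_snd, pullback.lift_snd]
  · intro _ Z f g
    ext
    rw [← cancel_mono P.hom, MorphismProperty.Over.w, MorphismProperty.Over.w]

theorem isEquivRel_of_isKernelPair {U V P : G} {d₀ d₁ : U ⟶ V} {p : V ⟶ P}
    (h : IsKernelPair p d₀ d₁) : IsEquivRel d₀ d₁ := by
  refine fun T => ⟨fun s t hs ht => h.hom_ext hs ht, ?_⟩
  have exists_iff (a b : T ⟶ V) : (∃ t : T ⟶ U, t ≫ d₀ = a ∧ t ≫ d₁ = b) ↔ a ≫ p = b ≫ p :=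
    ⟨by rintro ⟨t, rfl, rfl⟩; simp only [Category.assoc, h.w],
      fun hab => ⟨h.lift a b hab, h.lift_fst a b hab, h.lift_snd a b hab⟩⟩
  simp only [exists_iff]
  exact ⟨fun _ => rfl, fun h => h.symm, fun h h' => h.trans h'⟩

theorem isLocallyCoequalizable_of_isCoequalizable [O.ContainsIdentities] {U X : G}
    {d₀ d₁ : U ⟶ X} (h : IsCoequalizable O d₀ d₁) : IsLocallyCoequalizable O d₀ d₁ := by
  refine ⟨.singleton (𝟙 X), fun Z a b h => by simpa using h (f := 𝟙 X) ⟨⟩, ?_⟩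
  rintro _ _ ⟨⟩
  refine ⟨O.id_mem X, U, d₀, d₁, ⟨U, U, d₀, 𝟙 U, 𝟙 U, d₁, 𝟙 U, 𝟙 U, ?_, ?_, ?_, ?_, ?_⟩, h⟩
  · exact .of_vert_isIso ⟨by simp⟩
  · exact .of_horiz_isIso ⟨by simp⟩
  · exact .of_vert_isIso ⟨by simp⟩
  · exact (Category.id_comp _).symm
  · exact (Category.id_comp _).symm

namespace IsGlutos

variable [hO : IsGlutos O] {X Y : G}

theorem exists_epi_fac {p : X ⟶ Y} (hp : O p) :
    ∃ (Q : G) (q : X ⟶ Q) (m : Q ⟶ Y), q ≫ m = p ∧ Epi q ∧ O m ∧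
      ∀ ⦃T : G⦄ (s t : T ⟶ X), s ≫ p = t ≫ p → s ≫ q = t ≫ q := by
  have := IsClopos.hasPullback p p hp
  have hk := IsKernelPair.of_hasPullback p
  obtain ⟨Q, q, hq, hqO, hqU, -⟩ := hO.exists_coequalizer _ _ (isEquivRel_of_isKernelPair hk)
    (O.pullback_fst _ _ hp) (O.pullback_snd _ _ hp)
    (isLocallyCoequalizable_of_isCoequalizable ⟨_, p, hp, hk.w⟩)
  have hc := hqU.isColimit
  have hqe : Epi q := ⟨fun a b h => Cofork.IsColimit.hom_ext hc h⟩
  let m : Q ⟶ Y := Cofork.IsColimit.desc hc p hk.w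
  have hm : q ≫ m = p := Cofork.IsColimit.π_desc' hc p hk.w
  refine ⟨Q, q, m, hm, hqe, hO.of_precomp q m hqe hqO (by rwa [hm]), fun T s t h => ?_⟩
  rw [← hk.lift_fst _ _ h, Category.assoc, hq, ← Category.assoc, hk.lift_snd]

theorem epi_left {V P : O.Over ⊤ X} (p : V ⟶ P) [Epi p] : Epi p.left := by
  have hp : O p.left := hO.of_postcomp p.left P.hom P.prop (by
    rw [MorphismProperty.Over.w]
    exact V.prop)
  obtain ⟨Q, q, m, hm, hq, hmO, hqp⟩ := exists_epi_fac hp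
  let Q' : O.Over ⊤ X := MorphismProperty.Over.mk ⊤ (m ≫ P.hom) (O.comp_mem _ _ hmO P.prop)
  let q' : V ⟶ Q' := MorphismProperty.Over.homMk q (by
    change q ≫ m ≫ P.hom = V.hom
    rw [reassoc_of% hm, MorphismProperty.Over.w])
  let m' : Q' ⟶ P := MorphismProperty.Over.homMk m
  have hm' : q' ≫ m' = p := by
    ext
    exact hm
  have := (hO.isTopos X).effectiveEpi p
  let n : P ⟶ Q' := EffectiveEpi.desc p q' fun {T} s t hst => by
    ext
    exact hqp s.left t.left (congrArg (fun k : T ⟶ P => k.left) hst)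
  have hnm : n ≫ m' = 𝟙 P := by
    rw [← cancel_epi p, EffectiveEpi.fac_assoc, hm', Category.comp_id]
  have : IsSplitEpi m := ⟨⟨n.left, congrArg (fun k : P ⟶ P => k.left) hnm⟩⟩
  rw [← hm]
  exact epi_comp q m

theorem exists_coproduct_desc {ι : Type u} {U : ι → G} (f : ∀ i, U i ⟶ X) :
    ∃ (V : G) (j : ∀ i, U i ⟶ V) (p : V ⟶ X), (∀ i, j i ≫ p = f i) ∧
      (∀ ⦃Z : G⦄ (a b : V ⟶ Z), (∀ i, j i ≫ a = j i ≫ b) → a = b) ∧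
      ∀ ⦃Z : G⦄ (g : V ⟶ Z), (∀ i, O (j i ≫ g)) → O g := by
  obtain ⟨c, hc, -⟩ := hO.exists_coproduct U
  have hc := hc.isColimit
  exact ⟨c.pt, c.inj, Cofan.IsColimit.desc hc f, Cofan.IsColimit.fac hc f,
    fun _ _ _ => Cofan.IsColimit.hom_ext hc _ _, hO.of_coproduct c hc⟩

theorem isEpiSink_left {ι : Type u} {V : ι → O.Over ⊤ X} {P : O.Over ⊤ X} {f : ∀ i, V i ⟶ P}
    (hf : IsEpiSink (Presieve.ofArrows V f)) :
    IsEpiSink (Presieve.ofArrows (fun i => (V i).left) fun i => (f i).left) := by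
  obtain ⟨W, j, p, hp, hj, hjO⟩ := exists_coproduct_desc (O := O) fun i => (f i).left
  let W' : O.Over ⊤ X := MorphismProperty.Over.mk ⊤ (p ≫ P.hom) (hjO _ fun i => by
    rw [reassoc_of% hp, MorphismProperty.Over.w]
    exact (V i).prop)
  let p' : W' ⟶ P := MorphismProperty.Over.homMk p
  have : Epi p' := ⟨fun {Q} a b hab => hf a b fun _ _ ⟨i⟩ => by
    ext
    have hab : p ≫ a.left = p ≫ b.left := congrArg (fun k : W' ⟶ Q => k.left) hab
    change (f i).left ≫ a.left = (f i).left ≫ b.left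
    rw [← hp, Category.assoc, hab, Category.assoc]⟩
  have : Epi p := epi_left p'
  intro Z a b h
  refine (cancel_epi p).1 (hj _ _ fun i => ?_)
  rw [reassoc_of% hp, reassoc_of% hp]
  exact h (.mk i)

theorem locallyClopen_hom_of_isSubterminalGenerated {P : O.Over ⊤ X}
    (hP : IsSubterminalGenerated P) : locallyClopen (monoPart (openEpi O)) P.hom := by
  obtain ⟨ι, K, hK, hK'⟩ := (hO.isTopos X).exists_small_subterminals
  let f (k : Σ i, (K i ⟶ P)) : K k.1 ⟶ P := k.2
  have isEpiSink_f : IsEpiSink (Presieve.ofArrows _ f) := fun Q a b h => hP a b fun L hL s => by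
    obtain ⟨i, ⟨e⟩⟩ := hK' L hL
    rw [← cancel_epi e.hom, ← Category.assoc, ← Category.assoc]
    exact h (Presieve.ofArrows.mk (f := f) ⟨i, e.hom ≫ s⟩)
  have open_f (k) : O ((f k).left ≫ P.hom) := by
    rw [MorphismProperty.Over.w]
    exact (K k.1).prop
  have mono_f (k) : Mono ((f k).left ≫ P.hom) := by
    rw [MorphismProperty.Over.w]
    exact (isSubterminal_iff_mono _).1 (hK k.1)
  refine ⟨_, ⟨⟨?_, isEpiSink_left isEpiSink_f⟩, ?_⟩, ?_⟩
  · rintro _ _ ⟨k⟩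
    exact hO.of_postcomp _ _ P.prop (open_f k)
  · rintro _ _ ⟨k⟩
    have := mono_f k
    exact mono_of_mono (f k).left P.hom
  · rintro _ _ ⟨k⟩
    exact (clopen_monoPart_iff _).2 ⟨open_f k, mono_f k⟩

theorem isSubterminalGenerated_iff_locallyClopen (P : O.Over ⊤ X) :
    IsSubterminalGenerated P ↔ locallyClopen (monoPart (openEpi O)) P.hom := by
  refine ⟨locallyClopen_hom_of_isSubterminalGenerated, fun ⟨S, hS, h⟩ Q a b hab => ?_⟩
  ext
  refine hS.1.2 _ _ fun U g hg => ?_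
  obtain ⟨hgO, hgm⟩ := (clopen_monoPart_iff _).1 (h hg)
  let L : O.Over ⊤ X := MorphismProperty.Over.mk ⊤ (g ≫ P.hom) hgO
  let s : L ⟶ P := MorphismProperty.Over.homMk g
  exact congrArg (fun k : L ⟶ Q => k.left) (hab ((isSubterminal_iff_mono L).2 hgm) s)

theorem exists_small_subcover {S : Presieve Y} (hS : S ∈ monoPart (openEpi O) Y) :
    ∃ (ι : Type u) (U : ι → G) (f : ∀ i, U i ⟶ Y),
      (∀ i, S (f i)) ∧ IsEpiSink (Presieve.ofArrows U f) := by
  obtain ⟨ι, K, -, hK⟩ := (hO.isTopos Y).exists_small_subterminals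
  let κ : Type u := {i : ι // ∃ (U : G) (f : U ⟶ Y), S f ∧
    ∃ h : (K i).left ≅ U, h.hom ≫ f = (K i).hom}
  choose U f hf k hk using fun i : κ => i.2
  refine ⟨κ, U, f, hf, fun Z a b h => hS.1.2 a b fun V g hg => ?_⟩
  let L : O.Over ⊤ Y := MorphismProperty.Over.mk ⊤ g (hS.1.1 hg)
  obtain ⟨i, ⟨e⟩⟩ := hK L ((isSubterminal_iff_mono _).2 (hS.2 hg))
  let e' : (K i).left ≅ V := (MorphismProperty.Over.forget O ⊤ Y ⋙ Over.forget Y).mapIso e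
  let i' : κ := ⟨i, V, g, hg, e', MorphismProperty.Over.w e.hom⟩
  have hg' : e'.inv ≫ (k i').hom ≫ f i' = g := by
    rw [hk]
    exact MorphismProperty.Over.w e.inv
  rw [← hg', Category.assoc, Category.assoc, h (.mk i'), Category.assoc, Category.assoc]

theorem of_isEpiSink {ι : Type u} {U : ι → G} {g : ∀ i, U i ⟶ Y} (hg : ∀ i, O (g i))
    (hg' : IsEpiSink (Presieve.ofArrows U g)) {f : Y ⟶ X} (h : ∀ i, O (g i ≫ f)) : O f := by
  obtain ⟨V, j, p, hp, -, hjO⟩ := exists_coproduct_desc (O := O) g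
  refine hO.of_precomp p f ⟨fun a b hab => hg' a b ?_⟩ (hjO p fun i => ?_)
    (hjO _ fun i => ?_)
  · rintro _ _ ⟨i⟩
    rw [← hp, Category.assoc, hab, Category.assoc]
  · exact hp i ▸ hg i
  · rw [reassoc_of% hp]
    exact h i

theorem of_locallyClopen {f : Y ⟶ X} (hf : locallyClopen (monoPart (openEpi O)) f) : O f := by
  obtain ⟨S, hS, h⟩ := hf
  obtain ⟨ι, U, g, hg, hg'⟩ := exists_small_subcover hS
  exact of_isEpiSink (fun i => hS.1.1 (hg i)) hg'
    fun i => ((clopen_monoPart_iff _).1 (h (hg i))).1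

end IsGlutos

end OpenArrows

section Comparison

variable {C : Type w} [Category.{u} C] {τ : Precoverage C}

instance [τ.HasPullbacks] [τ.IsStableUnderBaseChange] :
    (clopen τ).IsStableUnderBaseChange where
  of_isPullback {U Y Y' X f g fst snd} h := by
    rintro ⟨S, hS, hg⟩
    have := Precoverage.hasPullbacks_of_mem f hS
    let ι := {k : Σ (Z W : C), (Z ⟶ X) × (W ⟶ U) × (W ⟶ Z) //
      S k.2.2.1 ∧ IsPullback k.2.2.2.1 k.2.2.2.2 f k.2.2.1}
    have hS' : Presieve.ofArrows (fun k : ι => k.1.1) (fun k => k.1.2.2.1) = S := by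
      refine le_antisymm ?_ fun Z s hs => ?_
      · rintro _ _ ⟨k⟩
        exact k.2.1
      · have := Presieve.HasPullbacks.hasPullback f hs
        exact .mk (⟨⟨Z, _, s, _, _⟩, hs, (IsPullback.of_hasPullback s f).flip⟩ : ι)
    exact ⟨_, Precoverage.mem_coverings_of_isPullback _ (by rwa [hS']) f
      (fun k : ι => k.1.2.2.2.1) (fun k => k.1.2.2.2.2) fun k => k.2.2,
      .mk (⟨⟨_, _, g, snd, fst⟩, hg, h.flip⟩ : ι)⟩

theorem IsContinuous.map_locallyClopen {G : Type w'} [Category.{v'} G] {σ : Precoverage G}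
    {F : C ⥤ G} (hF : IsContinuous τ σ F) {Y X : C} {f : Y ⟶ X} (hf : locallyClopen τ f) :
    locallyClopen σ (F.map f) := by
  obtain ⟨S, hS, h⟩ := hf
  refine ⟨_, hF.map_mem hS, ?_⟩
  rintro _ _ ⟨hg⟩
  rw [← Functor.map_comp]
  exact hF.map_clopen (h hg)

theorem locallyClopen.comp_isIso [(clopen τ).RespectsIso] {Y X X' : C} {f : Y ⟶ X}
    (hf : locallyClopen τ f) (j : X ⟶ X') [IsIso j] : locallyClopen τ (f ≫ j) := by
  obtain ⟨S, hS, h⟩ := hf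
  refine ⟨S, hS, fun Z g hg => ?_⟩
  rw [← Category.assoc, (clopen τ).cancel_right_of_respectsIso]
  exact h hg

section Incl

variable [IsPresite τ] {X : C}

instance : (incl τ X).Full where
  map_surjective {U V} k := by
    refine ⟨homOfLE (Subobject.le_of_comm k.left (MorphismProperty.Over.w k)), ?_⟩
    ext
    refine (cancel_mono V.1.arrow).1 ?_
    exact (Subobject.ofLE_arrow _).trans (MorphismProperty.Over.w k).symm

theorem essImage_incl_of_mono {P : LocallyClopenOver τ X} (hP : clopen τ P.hom) [Mono P.hom] :
    (incl τ X).essImage P := by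
  let i := Subobject.underlyingIso P.hom
  have hi : i.hom ≫ P.hom = (Subobject.mk P.hom).arrow :=
    Subobject.underlyingIso_hom_comp_eq_mk P.hom
  have hU : clopen τ (Subobject.mk P.hom).arrow := by
    rwa [← hi, (clopen τ).cancel_left_of_respectsIso]
  exact ⟨⟨Subobject.mk P.hom, hU⟩, ⟨MorphismProperty.Over.isoMk i hi⟩⟩

end Incl

section ToOpenOver

variable {G : Type w'} [Category.{u} G] {O : MorphismProperty G} [IsGlutos O]
  {F : C ⥤ G} (hF : IsContinuous τ (monoPart (openEpi O)) F) (X : C)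

/-- The functor which sends a locally clopen arrow to `X` to its image under `F`. This image is open
by `IsGlutos.of_locallyClopen`. -/
def toOpenOver : LocallyClopenOver τ X ⥤ O.Over ⊤ (F.obj X) :=
  MorphismProperty.Comma.lift (MorphismProperty.Over.forget _ _ X ⋙ Over.post F)
    (fun P => IsGlutos.of_locallyClopen (hF.map_locallyClopen P.prop))
    (fun _ => trivial) fun _ => trivial

instance [F.Faithful] : (toOpenOver hF X).Faithful :=
  have : (toOpenOver hF X ⋙ MorphismProperty.Over.forget _ _ _).Faithful :=
    inferInstanceAs (MorphismProperty.Over.forget (locallyClopen τ) ⊤ X ⋙ Over.post F).Faithful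
  .of_comp _ (MorphismProperty.Over.forget _ _ _)

instance [F.Full] [F.Faithful] : (toOpenOver hF X).Full :=
  have : (toOpenOver hF X ⋙ MorphismProperty.Over.forget _ _ _).Full :=
    inferInstanceAs (MorphismProperty.Over.forget (locallyClopen τ) ⊤ X ⋙ Over.post F).Full
  .of_comp_faithful _ (MorphismProperty.Over.forget _ _ _)

end ToOpenOver

section EssImage

variable [IsPresite τ] {G : Type w'} [Category.{u} G] {O : MorphismProperty G} [IsGlutos O]
  {e : C ≌ G} (he : IsContinuous τ (monoPart (openEpi O)) e.functor) {X : C}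
  (P : O.Over ⊤ (e.functor.obj X))

/-- An open arrow to `e.functor.obj X` is recovered from the arrow to `X` which corresponds to it
under the equivalence `e`. -/
def toOpenOverObjIso (hP : locallyClopen τ (e.inverse.map P.hom ≫ e.unitInv.app X)) :
    (toOpenOver he X).obj (MorphismProperty.Over.mk ⊤ _ hP) ≅ P :=
  MorphismProperty.Over.isoMk (e.counitIso.app P.left) (by
    change e.counit.app P.left ≫ P.hom = e.functor.map (e.inverse.map P.hom ≫ e.unitInv.app X)
    simp)

theorem essImage_toOpenOver_iff (he' : IsContinuous (monoPart (openEpi O)) τ e.inverse) :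
    (toOpenOver he X).essImage P ↔ IsSubterminalGenerated P := by
  constructor
  · rintro ⟨Q, ⟨k⟩⟩
    have hQ : IsSubterminalGenerated ((toOpenOver he X).obj Q) :=
      (IsGlutos.isSubterminalGenerated_iff_locallyClopen _).2 (he.map_locallyClopen Q.prop)
    exact hQ.of_epi k.hom
  · intro hP
    have hf := (he'.map_locallyClopen
      ((IsGlutos.isSubterminalGenerated_iff_locallyClopen P).1 hP)).comp_isIso (e.unitInv.app X)
    exact ⟨_, ⟨toOpenOverObjIso he P hf⟩⟩

theorem essImage_incl_comp_toOpenOver_iff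
    (he' : IsContinuous (monoPart (openEpi O)) τ e.inverse) :
    (incl τ X ⋙ toOpenOver he X).essImage P ↔ IsSubterminal P := by
  constructor
  · rintro ⟨U, ⟨k⟩⟩
    refine isSubterminal_of_mono k.inv ((isSubterminal_iff_mono _).2 ?_)
    exact inferInstanceAs (Mono (e.functor.map U.1.arrow))
  · intro hP
    have : Mono P.hom := (isSubterminal_iff_mono P).1 hP
    have hf : clopen τ (e.inverse.map P.hom ≫ e.unitInv.app X) := by
      rw [(clopen τ).cancel_right_of_respectsIso]
      exact he'.map_clopen ((clopen_monoPart_iff _).2 ⟨P.prop, this⟩)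
    let Q : LocallyClopenOver τ X :=
      MorphismProperty.Over.mk ⊤ _ (locallyClopen_of_clopen τ hf)
    have : Mono Q.hom := inferInstanceAs (Mono (e.inverse.map P.hom ≫ e.unitInv.app X))
    obtain ⟨U, ⟨k⟩⟩ := essImage_incl_of_mono (P := Q) hf
    exact ⟨U, ⟨(toOpenOver he X).mapIso k ≪≫ toOpenOverObjIso he P _⟩⟩

end EssImage

end Comparison

end Glutos

theorem mainTheorem8_general {C : Type w} [Category.{u} C] (τ : Precoverage C)
    [Glutos.IsPresite τ] {G : Type w'} [Category.{u} G] (O : MorphismProperty G)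
    [Glutos.IsGlutos O] (e : C ≌ G)
    (he : Glutos.IsContinuous τ (Glutos.monoPart (Glutos.openEpi O)) e.functor)
    (he' : Glutos.IsContinuous (Glutos.monoPart (Glutos.openEpi O)) τ e.inverse) (X : C) :
    Small.{u} (Glutos.ClopenSubobject τ X) ∧
    Glutos.IsCompleteHeyting (Glutos.ClopenSubobject τ X) ∧
    Glutos.IsSGTopos.{max w (u + 1), max w u, u} (Glutos.Sh τ X) ∧
    ∃ (J : Glutos.Sh τ X ⥤ Glutos.LocallyClopenOver τ X)
      (β : sheafToPresheaf _ _ ≅ J ⋙ Glutos.sections τ X),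
      J.IsEquivalence ∧
      ∀ F : Glutos.Sh τ X,
        (∀ i j : Glutos.Index F.obj, ∃ k, IsGLB {i, j} k) ∧
        Nonempty (IsColimit (Glutos.gluingCocone (β.hom.app F))) := by
  obtain ⟨hsmall, hHeyting, E, ⟨κ⟩⟩ := Glutos.exists_equivalence_sheaf
    (Glutos.IsGlutos.isTopos (e.functor.obj X)) (Glutos.incl τ X) (Glutos.toOpenOver he X)
    (fun P => Glutos.essImage_incl_comp_toOpenOver_iff he P he')
    (fun P => Glutos.essImage_toOpenOver_iff he P he')
  have : (Glutos.sections τ X).Full := .of_iso κ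
  have : (Glutos.sections τ X).Faithful := .of_iso κ
  let β : sheafToPresheaf _ _ ≅ E.inverse ⋙ Glutos.sections τ X :=
    Functor.isoWhiskerRight E.counitIso.symm (sheafToPresheaf _ _) ≪≫
      Functor.isoWhiskerLeft E.inverse κ
  refine ⟨hsmall, hHeyting, ⟨Glutos.isTopos_sheaf_canonicalTopology _,
    Glutos.isSeparating_isSubterminal _⟩, E.inverse, β, inferInstance, fun F => ?_⟩
  exact ⟨Glutos.exists_isGLB_index hHeyting F, Glutos.nonempty_isColimit_gluingCocone _⟩

theorem mainTheorem8 {C : Type w} [Category.{u} C] (τ : Precoverage C) [Glutos.IsPresite τ]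
    (hτ : Glutos.IsNearlyGlutos τ) (X : C) :
    Small.{u} (Glutos.ClopenSubobject τ X) ∧
    Glutos.IsCompleteHeyting (Glutos.ClopenSubobject τ X) ∧
    Glutos.IsSGTopos.{max w (u + 1), max w u, u} (Glutos.Sh τ X) ∧
    ∃ (J : Glutos.Sh τ X ⥤ Glutos.LocallyClopenOver τ X)
      (β : sheafToPresheaf _ _ ≅ J ⋙ Glutos.sections τ X),
      J.IsEquivalence ∧
      ∀ F : Glutos.Sh τ X,
        (∀ i j : Glutos.Index F.obj, ∃ k, IsGLB {i, j} k) ∧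
        Nonempty (IsColimit (Glutos.gluingCocone (β.hom.app F))) := by
  obtain ⟨-, P, _, σ, G, _, O, Y, e, -, -, hY, he, he'⟩ := hτ
  have := hY.isGlutos
  exact mainTheorem8_general τ O e he he' X
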